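/- All manifolds are finite-dimensional, Hausdorff and $C^\infty$. Let $G\rightrightarrows M$ be a Lie groupoid with source $\alpha$, target $\beta$ (smooth submersions), identity section $\epsilon$, inversion $i$ and multiplication $(g,h)\mapsto gh$, defined on $G_2=\{(g,h):\beta(g)=\alpha(h)\}$, all smooth. Its Lie algebroid $AG$ has fibres $A_xG=\ker T_{\epsilon(x)}\alpha$. Write $l_g(k)=gk$ and $r_h(k)=kh$, $V_g\alpha=\ker T_g\alpha$, $V_g\beta=\ker T_g\beta$. For a smooth function (discrete Lagrangian) $L:G\to\mathbb R$ and $(g,h)\in G_2$ with $x=\beta(g)=\alpha(h)$, the discrete Euler–Lagrange operator is the linear form on $A_xG$ $$D_{\mathrm{DEL}}L(g,h)=d\left[L\circ l_g+L\circ r_h\circ i\right](\epsilon(x))\big|_{A_xG},$$ where $L\circ l_g+L\circ r_h\circ i$ is a function on $\alpha^{-1}(x)$. Let $\mathcal P^\tau G=V\beta\oplus_G V\alpha\to G$, with its Lie algebroid structure: the anchor is $(X,Y)\mapsto X+Y$, and the bracket is the one with $[(X,Y),(X',Y')]=([X,X'],[Y,Y'])$ for right-invariant $X,X'\in\Gamma(V\beta)$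 and left-invariant $Y,Y'\in\Gamma(V\alpha)$. Let $d$ also denote the differential of this Lie algebroid. The Poincaré–Cartan sections of $L$ are $$\Theta_L^-(g)(X_g,Y_g)=-X_g(L),\qquad \Theta_L^+(g)(X_g,Y_g)=Y_g(L),\qquad \Omega_L=-d\Theta_L^+ .$$ Let $G'\rightrightarrows M'$ be a second Lie groupoid and $\Phi:G\to G'$ a morphism of Lie groupoids, that is, a smooth map with $(\Phi(g),\Phi(h))\in G'_2$ and $\Phi(gh)=\Phi(g)\Phi(h)$ for all $(g,h)\in G_2$. Let $\Phi_0:M\to M'$ be the induced map, $A_x\Phi:A_xG\to A_{\Phi_0(x)}G'$ the restriction of $T_{\epsilon(x)}\Phi$, and $$\mathcal P^\tau_g\Phi:V_g\beta\oplus V_g\alpha\to V_{\Phi(g)}\beta'\oplus V_{\Phi(g)}\alpha',\qquad \mathcal P^\tau_g\Phi(V,W)=(T_g\Phi(V),T_g\Phi(W)).$$ **Theorem.** Let $L:G\to\mathbb R$ and $L':G'\to\mathbb R$ be discrete Lagrangians with $L=L'\circ\Phi$. Then: 1. for every $(g,h)\in G_2$ and every $v\in A_{\beta(g)}G$, $$D_{\mathrm{DEL}}L(g,h)(v)=D_{\mathrm{DEL}}L'(\Phi(g),\Phi(h))\left(A_{\beta(g)}\Phi(v)\right);$$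 2. $(\mathcal P^\tau\Phi,\Phi)^*\Theta^+_{L'}=\Theta^+_L$; 3. $(\mathcal P^\tau\Phi,\Phi)^*\Theta^-_{L'}=\Theta^-_L$; 4. $(\mathcal P^\tau\Phi,\Phi)^*\Omega_{L'}=\Omega_L$. -/

import Mathlib

open scoped Topology Manifold ContDiff

section VerticalFields

open Set Filter Manifold

set_option linter.unusedSectionVars false

variable {E F E' : Type*} [NormedAddCommGroup E] [NormedSpace ℝ E]
  [NormedAddCommGroup F] [NormedSpace ℝ F] [NormedAddCommGroup E'] [NormedSpace ℝ E']
  {G M G' : Type*} [TopologicalSpace G] [ChartedSpace E G] [IsManifold 𝓘(ℝ, E) ∞ G]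
  [TopologicalSpace M] [ChartedSpace F M] [IsManifold 𝓘(ℝ, F) ∞ M]
  [TopologicalSpace G'] [ChartedSpace E' G']

/-- Every vertical tangent vector of a submersion is the velocity of a curve in the fibre. -/
theorem exists_curve_in_fiber {f : G → M} (hf : IsSubmersion 𝓘(ℝ, E) 𝓘(ℝ, F) ∞ f) (x : G)
    (v : TangentSpace 𝓘(ℝ, E) x) (hv : mfderiv 𝓘(ℝ, E) 𝓘(ℝ, F) f x v = 0) :
    ∃ γ : ℝ → G, γ 0 = x ∧
      HasMFDerivAt 𝓘(ℝ, ℝ) 𝓘(ℝ, E) γ 0 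
        (ContinuousLinearMap.toSpanSingleton ℝ (v : E) : ℝ →L[ℝ] E) ∧
      ∀ᶠ t in 𝓝 (0 : ℝ), f (γ t) = f x := by
  obtain ⟨K, _, _, h⟩ := hf.isSubmersionAt x
  set φ := h.domChart with hφ
  set ψ := h.codChart with hψ
  have hxs : x ∈ φ.source := h.mem_domChart_source
  have hfs : f x ∈ ψ.source := h.mem_codChart_source
  have hφm := h.domChart_mem_maximalAtlas
  have hψm := h.codChart_mem_maximalAtlas
  have heq := h.writtenInCharts
  simp only [mfld_simps] at heq
  have dφ : MDifferentiableAt 𝓘(ℝ, E) 𝓘(ℝ, E) φ x :=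
    (contMDiffAt_of_mem_maximalAtlas hφm hxs).mdifferentiableAt (by simp)
  have dφs : MDifferentiableAt 𝓘(ℝ, E) 𝓘(ℝ, E) φ.symm (φ x) :=
    (contMDiffAt_symm_of_mem_maximalAtlas hφm (φ.map_source hxs)).mdifferentiableAt (by simp)
  have dψ : MDifferentiableAt 𝓘(ℝ, F) 𝓘(ℝ, F) ψ (f x) :=
    (contMDiffAt_of_mem_maximalAtlas hψm hfs).mdifferentiableAt (by simp)
  have df : MDifferentiableAt 𝓘(ℝ, E) 𝓘(ℝ, F) f x :=
    (hf.contMDiff x).mdifferentiableAt (by simp)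
  set w : E := mfderiv 𝓘(ℝ, E) 𝓘(ℝ, E) φ x v with hw
  have hback : ∀ y ∈ φ.source, ψ (f y) = (h.equiv (φ y)).1 := by
    intro y hy
    have e := heq (φ.map_source hy)
    have e' : ψ (f (φ.symm (φ y))) = (h.equiv (φ y)).1 := e
    rwa [φ.left_inv hy] at e'
  have hw0 : (h.equiv w).1 = 0 := by
    have e1 : HasMFDerivAt 𝓘(ℝ, E) 𝓘(ℝ, F) (ψ ∘ f) x _ := dψ.hasMFDerivAt.comp x df.hasMFDerivAt
    have e2 : HasMFDerivAt 𝓘(ℝ, E) 𝓘(ℝ, F) (fun y => (h.equiv (φ y)).1) x _ :=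
      ((ContinuousLinearMap.fst ℝ F K ∘L (h.equiv : E →L[ℝ] F × K)).hasMFDerivAt (x := φ x)).comp x
        dφ.hasMFDerivAt
    have e3 := e1.congr_of_eventuallyEq (f₁ := fun y => (h.equiv (φ y)).1)
      (by filter_upwards [φ.open_source.mem_nhds hxs] with y hy; exact (hback y hy).symm)
    have := hasMFDerivAt_unique e2 e3
    have := congrArg (fun (A : E →L[ℝ] F) => A (v : E)) this
    refine Eq.trans this ?_
    show mfderiv 𝓘(ℝ, F) 𝓘(ℝ, F) ψ (f x) (mfderiv 𝓘(ℝ, E) 𝓘(ℝ, F) f x v) = 0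
    rw [hv]; simp
  have dline : HasMFDerivAt 𝓘(ℝ, ℝ) 𝓘(ℝ, E) (fun t : ℝ => φ x + t • w) 0
      (ContinuousLinearMap.toSpanSingleton ℝ w : ℝ →L[ℝ] E) := by
    apply HasFDerivAt.hasMFDerivAt
    exact ((ContinuousLinearMap.toSpanSingleton ℝ w).hasFDerivAt (x := (0:ℝ))).const_add (φ x)
  have hcont : Tendsto (fun t : ℝ => φ x + t • w) (𝓝 0) (𝓝 (φ x)) := by
    have : Continuous (fun t : ℝ => φ x + t • w) := by fun_prop
    simpa using this.tendsto 0
  have hev : ∀ᶠ t in 𝓝 (0:ℝ), φ x + t • w ∈ φ.target :=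
    hcont (φ.open_target.mem_nhds (φ.map_source hxs))
  refine ⟨fun t => φ.symm (φ x + t • w), by simp [hxs], ?_, ?_⟩
  · have dφs' : HasMFDerivAt 𝓘(ℝ, E) 𝓘(ℝ, E) φ.symm (φ x + (0:ℝ) • w)
        (mfderiv 𝓘(ℝ, E) 𝓘(ℝ, E) φ.symm (φ x) : E →L[ℝ] E) := by
      have e : φ x + (0:ℝ) • w = φ x := by simp
      rw [e]
      exact dφs.hasMFDerivAt
    have := dφs'.comp (0:ℝ) dline
    refine HasMFDerivAt.congr_mfderiv this ?_
    have inv : (mfderiv 𝓘(ℝ, E) 𝓘(ℝ, E) φ.symm (φ x) : E →L[ℝ] E) w = v := by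
      have c := dφs.hasMFDerivAt.comp x dφ.hasMFDerivAt
      have c2 := (hasMFDerivAt_id (I := 𝓘(ℝ, E)) x).congr_of_eventuallyEq (f₁ := φ.symm ∘ φ)
        (by filter_upwards [φ.open_source.mem_nhds hxs] with y hy; simp [hy])
      have := hasMFDerivAt_unique c c2
      exact congrArg (fun (A : E →L[ℝ] E) => A (v : E)) this
    refine ContinuousLinearMap.ext_ring ?_
    show (mfderiv 𝓘(ℝ, E) 𝓘(ℝ, E) φ.symm (φ x) : E →L[ℝ] E) ((1:ℝ) • w) = (1:ℝ) • (v:E)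
    rw [one_smul, one_smul, inv]
  · have hfin : ∀ᶠ t in 𝓝 (0:ℝ), φ.symm (φ x + t • w) ∈ φ.source := by
      filter_upwards [hev] with t ht using φ.map_target ht
    filter_upwards [hev, hfin] with t ht ht'
    apply ψ.injOn (h.source_subset_preimage_source ht') hfs
    rw [hback _ ht', hback _ hxs, φ.right_inv ht]
    simp [hw0]

/-- If `P ∘ Φ` is constant on the fibre of `f` through `x`, then the derivative of `Φ` along that
fibre maps vertical vectors to vectors that are annihilated by the derivative of `P`. -/
theorem mfderiv_mfderivWithin_fiber_eq_zero {F'' : Type*} [NormedAddCommGroup F'']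
    [NormedSpace ℝ F''] {N : Type*} [TopologicalSpace N] [ChartedSpace F'' N]
    {f : G → M} (hf : IsSubmersion 𝓘(ℝ, E) 𝓘(ℝ, F) ∞ f) (x : G)
    (v : TangentSpace 𝓘(ℝ, E) x) (hv : mfderiv 𝓘(ℝ, E) 𝓘(ℝ, F) f x v = 0)
    (Φ : G → G') (P : G' → N) (hP : MDifferentiableAt 𝓘(ℝ, E') 𝓘(ℝ, F'') P (Φ x)) (c : N)
    (hc : ∀ y, f y = f x → P (Φ y) = c) :
    mfderiv 𝓘(ℝ, E') 𝓘(ℝ, F'') P (Φ x)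
      (mfderivWithin 𝓘(ℝ, E) 𝓘(ℝ, E') Φ (f ⁻¹' {f x}) x v) = 0 := by
  by_cases hΦ : MDifferentiableWithinAt 𝓘(ℝ, E) 𝓘(ℝ, E') Φ (f ⁻¹' {f x}) x
  swap
  · rw [mfderivWithin_zero_of_not_mdifferentiableWithinAt hΦ]
    exact map_zero _
  obtain ⟨γ, rfl, hγ, hfib⟩ := exists_curve_in_fiber hf x v hv
  have h1 := (hP.hasMFDerivAt.comp_hasMFDerivWithinAt _ hΦ.hasMFDerivWithinAt).comp (0 : ℝ)
    hγ.hasMFDerivWithinAt (s := {t | f (γ t) = f (γ 0)}) (fun t ht => ht)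
  have h2 := h1.hasMFDerivAt hfib
  have h3 := (hasMFDerivAt_const (I := 𝓘(ℝ, ℝ)) (I' := 𝓘(ℝ, F'')) c (0 : ℝ)).congr_of_eventuallyEq
    (f₁ := (P ∘ Φ) ∘ γ) (by filter_upwards [hfib] with t ht using hc _ ht)
  have h4 := congrArg (fun (A : ℝ →L[ℝ] F'') => A 1) (hasMFDerivAt_unique h2 h3)
  have h5 : mfderiv 𝓘(ℝ, E') 𝓘(ℝ, F'') P (Φ (γ 0))
      (mfderivWithin 𝓘(ℝ, E) 𝓘(ℝ, E') Φ (f ⁻¹' {f (γ 0)}) (γ 0) ((1:ℝ) • v)) = 0 := h4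
  rwa [one_smul] at h5

/-- The Lie bracket of vertical vector fields is vertical. -/
theorem mfderiv_mlieBracket_eq_zero [CompleteSpace E] {f : G → M}
    (hf : ContMDiff 𝓘(ℝ, E) 𝓘(ℝ, F) ∞ f) (V W : ∀ g : G, TangentSpace 𝓘(ℝ, E) g)
    (hV : ContMDiff 𝓘(ℝ, E) 𝓘(ℝ, E).tangent ∞ (fun g => (⟨g, V g⟩ : TangentBundle 𝓘(ℝ, E) G)))
    (hW : ContMDiff 𝓘(ℝ, E) 𝓘(ℝ, E).tangent ∞ (fun g => (⟨g, W g⟩ : TangentBundle 𝓘(ℝ, E) G)))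
    (hfV : ∀ g, mfderiv 𝓘(ℝ, E) 𝓘(ℝ, F) f g (V g) = 0)
    (hfW : ∀ g, mfderiv 𝓘(ℝ, E) 𝓘(ℝ, F) f g (W g) = 0) (x : G) :
    mfderiv 𝓘(ℝ, E) 𝓘(ℝ, F) f x (VectorField.mlieBracket 𝓘(ℝ, E) V W x) = 0 := by
  have htwo : (2 : WithTop ℕ∞) ≤ ∞ := by
    exact WithTop.coe_le_coe.2 (le_top : (2 : ℕ∞) ≤ ⊤)
  have : IsManifold 𝓘(ℝ, E) 2 G := IsManifold.of_le (n := ∞) htwo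
  have : IsManifold 𝓘(ℝ, E) 1 G := IsManifold.of_le (n := ∞) (by exact_mod_cast le_top)
  have : IsManifold 𝓘(ℝ, F) 1 M := IsManifold.of_le (n := ∞) (by exact_mod_cast le_top)
  let e := extChartAt 𝓘(ℝ, E) x
  let ψ := extChartAt 𝓘(ℝ, F) (f x)
  let h : E → F := ψ ∘ f ∘ e.symm
  let V' : E → E := VectorField.mpullbackWithin 𝓘(ℝ, E) 𝓘(ℝ, E) e.symm V (range 𝓘(ℝ, E))
  let W' : E → E := VectorField.mpullbackWithin 𝓘(ℝ, E) 𝓘(ℝ, E) e.symm W (range 𝓘(ℝ, E))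
  have hset : e.symm ⁻¹' univ ∩ range 𝓘(ℝ, E) = univ := by
    rw [preimage_univ, univ_inter, ModelWithCorners.range_eq_univ]
  have hV' : DifferentiableAt ℝ V' (e x) := by
    have d : DifferentiableWithinAt ℝ V' (e.symm ⁻¹' univ ∩ range 𝓘(ℝ, E)) (e x) :=
      (((hV x).mdifferentiableAt (by simp)).mdifferentiableWithinAt
        (s := univ)).differentiableWithinAt_mpullbackWithin_vectorField
    rw [hset] at d
    exact differentiableWithinAt_univ.1 d
  have hW' : DifferentiableAt ℝ W' (e x) := by
    have d : DifferentiableWithinAt ℝ W' (e.symm ⁻¹' univ ∩ range 𝓘(ℝ, E)) (e x) :=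
      (((hW x).mdifferentiableAt (by simp)).mdifferentiableWithinAt
        (s := univ)).differentiableWithinAt_mpullbackWithin_vectorField
    rw [hset] at d
    exact differentiableWithinAt_univ.1 d
  have hh : ContDiffAt ℝ ∞ h (e x) := by
    have := (contMDiffAt_iff.1 (hf x)).2
    rwa [ModelWithCorners.range_eq_univ, contDiffWithinAt_univ] at this
  -- chain rule on a neighbourhood
  have hsrc : ∀ᶠ y in 𝓝 (e x), y ∈ e.target ∧ f (e.symm y) ∈ ψ.source := by
    refine Filter.Eventually.and (extChartAt_target_mem_nhds x) ?_
    have c : ContinuousAt (f ∘ e.symm) (e x) :=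
      (hf.continuous.continuousAt).comp (continuousAt_extChartAt_symm x)
    refine c.preimage_mem_nhds ?_
    have hex : e.symm (e x) = x := e.left_inv (mem_extChartAt_source x)
    simp only [Function.comp_apply, hex]
    exact extChartAt_source_mem_nhds (I := 𝓘(ℝ, F)) (f x)
  have chain : ∀ y, y ∈ e.target → f (e.symm y) ∈ ψ.source → ∀ u : E,
      fderiv ℝ h y u = mfderiv 𝓘(ℝ, F) 𝓘(ℝ, F) ψ (f (e.symm y))
        (mfderiv 𝓘(ℝ, E) 𝓘(ℝ, F) f (e.symm y) 
          (mfderivWithin 𝓘(ℝ, E) 𝓘(ℝ, E) e.symm (range 𝓘(ℝ, E)) y u)) := by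
    intro y hy hy' u
    have d1 := (mdifferentiableWithinAt_extChartAt_symm (I := 𝓘(ℝ, E)) hy).hasMFDerivWithinAt
    have d2 := ((hf (e.symm y)).mdifferentiableAt (by simp)).hasMFDerivAt
    have d3 := (mdifferentiableAt_extChartAt (I := 𝓘(ℝ, F)) (x := f x)
      (by simpa [ψ] using hy')).hasMFDerivAt
    have d := (d3.comp (e.symm y) d2).comp_hasMFDerivWithinAt y d1
    rw [ModelWithCorners.range_eq_univ, hasMFDerivWithinAt_univ] at d
    rw [← mfderiv_eq_fderiv]
    simp only [ModelWithCorners.range_eq_univ]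
    exact congrArg (fun (A : E →L[ℝ] F) => A u) (d.mfderiv)
  have vanish : ∀ (X : ∀ g : G, TangentSpace 𝓘(ℝ, E) g)
      (hX : ∀ g, mfderiv 𝓘(ℝ, E) 𝓘(ℝ, F) f g (X g) = 0), 
      ∀ᶠ y in 𝓝 (e x), fderiv ℝ h y (VectorField.mpullbackWithin 𝓘(ℝ, E) 𝓘(ℝ, E) e.symm X
        (range 𝓘(ℝ, E)) y : E) = 0 := by
    intro X hX
    filter_upwards [hsrc] with y hy
    refine (chain y hy.1 hy.2 _).trans ?_
    rw [VectorField.mpullbackWithin_apply,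
      (isInvertible_mfderivWithin_extChartAt_symm hy.1).self_apply_inverse, hX]
    exact map_zero _
  have hdh : DifferentiableAt ℝ (fderiv ℝ h) (e x) :=
    (hh.fderiv_right (m := 1) (by rw [one_add_one_eq_two]; exact htwo)).differentiableAt (by simp)
  have second : ∀ (X' : E → E), DifferentiableAt ℝ X' (e x) →
      (∀ᶠ y in 𝓝 (e x), fderiv ℝ h y (X' y) = 0) → ∀ u,
      fderiv ℝ h (e x) (fderiv ℝ X' (e x) u) = - fderiv ℝ (fderiv ℝ h) (e x) u (X' (e x)) := by
    intro X' hX' hz u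
    have d1 := HasFDerivAt.clm_apply (c := fderiv ℝ h) (u := X') hdh.hasFDerivAt hX'.hasFDerivAt
    have d2 := (hasFDerivAt_const (𝕜 := ℝ) (0 : F) (e x)).congr_of_eventuallyEq
      (f₁ := fun y => fderiv ℝ h y (X' y)) hz
    have := congrArg (fun (A : E →L[ℝ] F) => A u) (d1.unique d2)
    simp only [add_apply, ContinuousLinearMap.comp_apply,
      ContinuousLinearMap.flip_apply, zero_apply] at this
    exact eq_neg_of_add_eq_zero_left this
  have sym : IsSymmSndFDerivAt ℝ h (e x) := by
    apply ContDiffAt.isSymmSndFDerivAt (n := ∞) hh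
    simpa using htwo
  let b : E := VectorField.lieBracket (E := E) ℝ V' W' (e x)
  have hb : fderiv ℝ h (e x) b = 0 := by
    have hbb : b = fderiv ℝ W' (e x) (V' (e x)) - fderiv ℝ V' (e x) (W' (e x)) := rfl
    rw [hbb]
    simp only [map_sub]
    rw [second W' hW' (vanish W hfW), second V' hV' (vanish V hfV), sym.eq]
    simp
  have hx : x ∈ e.source := mem_extChartAt_source x
  have hex : e.symm (e x) = x := e.left_inv hx
  have hψ := isInvertible_mfderiv_extChartAt (I := 𝓘(ℝ, F)) (mem_extChartAt_source (I := 𝓘(ℝ, F)) (f x))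
  have key := chain (e x) (e.map_source hx) (by rw [hex]; exact mem_extChartAt_source _)
    b
  rw [hb] at key
  have hbr : (VectorField.mlieBracket 𝓘(ℝ, E) V W x : E) =
      mfderivWithin 𝓘(ℝ, E) 𝓘(ℝ, E) e.symm (range 𝓘(ℝ, E)) (e x)
        b := by
    have inv : (mfderiv 𝓘(ℝ, E) 𝓘(ℝ, E) e x : E →L[ℝ] E).inverse =
        (mfderivWithin 𝓘(ℝ, E) 𝓘(ℝ, E) e.symm (range 𝓘(ℝ, E)) (e x) : E →L[ℝ] E) := by
      apply ContinuousLinearMap.inverse_eq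
      · exact mfderiv_extChartAt_comp_mfderivWithin_extChartAt_symm' (I := 𝓘(ℝ, E)) hx
      · exact mfderivWithin_extChartAt_symm_comp_mfderiv_extChartAt' (I := 𝓘(ℝ, E)) hx
    have hbs : b = VectorField.lieBracketWithin (E := E) ℝ V' W'
        (e.symm ⁻¹' univ ∩ range 𝓘(ℝ, E)) (e x) := by
      rw [hset, VectorField.lieBracketWithin_univ]
    rw [← inv, hbs]
    rfl
  have key2 : mfderiv 𝓘(ℝ, E) 𝓘(ℝ, F) f (e.symm (e x))
      (mfderivWithin 𝓘(ℝ, E) 𝓘(ℝ, E) e.symm (range 𝓘(ℝ, E)) (e x)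
        b) = 0 := by
    rw [← (isInvertible_mfderiv_extChartAt (I := 𝓘(ℝ, F)) (x := f x) (y := f (e.symm (e x))) 
      (by rw [hex]; exact mem_extChartAt_source _)).injective.eq_iff, map_zero]
    exact key.symm
  have key3 : ∀ p : G, p = x → ∀ u : E, (mfderiv 𝓘(ℝ, E) 𝓘(ℝ, F) f p : E →L[ℝ] F) u = 0 →
      (mfderiv 𝓘(ℝ, E) 𝓘(ℝ, F) f x : E →L[ℝ] F) u = 0 := by
    rintro p rfl u hu
    exact hu
  rw [hbr]
  exact key3 _ hex _ key2

/-- Every vertical vector of a submersion is the value of a global smooth vertical vector field. -/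
theorem exists_smooth_vertical_field [FiniteDimensional ℝ E] [T2Space G] {f : G → M}
    (hf : IsSubmersion 𝓘(ℝ, E) 𝓘(ℝ, F) ∞ f) (x : G)
    (v : TangentSpace 𝓘(ℝ, E) x) (hv : mfderiv 𝓘(ℝ, E) 𝓘(ℝ, F) f x v = 0) :
    ∃ X : ∀ g : G, TangentSpace 𝓘(ℝ, E) g,
      (∀ g, mfderiv 𝓘(ℝ, E) 𝓘(ℝ, F) f g (X g) = 0) ∧
      ContMDiff 𝓘(ℝ, E) 𝓘(ℝ, E).tangent ∞ (fun g => (⟨g, X g⟩ : TangentBundle 𝓘(ℝ, E) G)) ∧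
      X x = v := by
  have hone : (1 : WithTop ℕ∞) ≤ ∞ := WithTop.coe_le_coe.2 (le_top : (1 : ℕ∞) ≤ ⊤)
  have : IsManifold 𝓘(ℝ, E) 1 G := IsManifold.of_le (n := ∞) hone
  obtain ⟨K, _, _, h⟩ := hf.isSubmersionAt x
  set φ := h.domChart with hφ
  set ψ := h.codChart with hψ
  have hxs : x ∈ φ.source := h.mem_domChart_source
  have hφm := h.domChart_mem_maximalAtlas
  have hψm := h.codChart_mem_maximalAtlas
  have heq := h.writtenInCharts
  simp only [mfld_simps] at heq
  have cφ : ∀ y ∈ φ.source, ContMDiffAt 𝓘(ℝ, E) 𝓘(ℝ, E) ∞ φ y :=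
    fun y hy => contMDiffAt_of_mem_maximalAtlas hφm hy
  have dφ : ∀ y ∈ φ.source, MDifferentiableAt 𝓘(ℝ, E) 𝓘(ℝ, E) φ y :=
    fun y hy => (cφ y hy).mdifferentiableAt (by simp)
  have dφs : ∀ y ∈ φ.source, MDifferentiableAt 𝓘(ℝ, E) 𝓘(ℝ, E) φ.symm (φ y) := fun y hy =>
    (contMDiffAt_symm_of_mem_maximalAtlas hφm (φ.map_source hy)).mdifferentiableAt (by simp)
  have dψ : ∀ y ∈ φ.source, MDifferentiableAt 𝓘(ℝ, F) 𝓘(ℝ, F) ψ (f y) := fun y hy =>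
    (contMDiffAt_of_mem_maximalAtlas hψm (h.source_subset_preimage_source hy)).mdifferentiableAt
      (by simp)
  have dψs : ∀ y ∈ φ.source, MDifferentiableAt 𝓘(ℝ, F) 𝓘(ℝ, F) ψ.symm (ψ (f y)) := fun y hy =>
    (contMDiffAt_symm_of_mem_maximalAtlas hψm
      (ψ.map_source (h.source_subset_preimage_source hy))).mdifferentiableAt (by simp)
  have df : ∀ y, MDifferentiableAt 𝓘(ℝ, E) 𝓘(ℝ, F) f y := fun y =>
    (hf.contMDiff y).mdifferentiableAt (by simp)
  have hback : ∀ y ∈ φ.source, ψ (f y) = (h.equiv (φ y)).1 := by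
    intro y hy
    have e := heq (φ.map_source hy)
    have e' : ψ (f (φ.symm (φ y))) = (h.equiv (φ y)).1 := e
    rwa [φ.left_inv hy] at e'
  have inv1 : ∀ y ∈ φ.source, (mfderiv 𝓘(ℝ, E) 𝓘(ℝ, E) φ.symm (φ y) : E →L[ℝ] E) ∘L
      (mfderiv 𝓘(ℝ, E) 𝓘(ℝ, E) φ y : E →L[ℝ] E) = ContinuousLinearMap.id ℝ E := by
    intro y hy
    have c := (dφs y hy).hasMFDerivAt.comp y (dφ y hy).hasMFDerivAt
    have c2 := (hasMFDerivAt_id (I := 𝓘(ℝ, E)) y).congr_of_eventuallyEq (f₁ := φ.symm ∘ φ)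
      (by filter_upwards [φ.open_source.mem_nhds hy] with z hz; simp [hz])
    exact hasMFDerivAt_unique c c2
  have inv2 : ∀ y ∈ φ.source, (mfderiv 𝓘(ℝ, E) 𝓘(ℝ, E) φ y : E →L[ℝ] E) ∘L
      (mfderiv 𝓘(ℝ, E) 𝓘(ℝ, E) φ.symm (φ y) : E →L[ℝ] E) = ContinuousLinearMap.id ℝ E := by
    intro y hy
    have l := inv1 y hy
    have := (LinearMap.comp_eq_id_comm ℝ E).1 (congrArg ContinuousLinearMap.toLinearMap l)
    exact ContinuousLinearMap.coe_injective this
  have hinv : ∀ y ∈ φ.source, (mfderiv 𝓘(ℝ, E) 𝓘(ℝ, E) φ y).IsInvertible := fun y hy =>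
    ContinuousLinearMap.IsInvertible.of_inverse (inv2 y hy) (inv1 y hy)
  have tang : ∀ y ∈ φ.source, ∀ u : TangentSpace 𝓘(ℝ, E) y,
      mfderiv 𝓘(ℝ, F) 𝓘(ℝ, F) ψ (f y) (mfderiv 𝓘(ℝ, E) 𝓘(ℝ, F) f y u) =
        (h.equiv (mfderiv 𝓘(ℝ, E) 𝓘(ℝ, E) φ y u : E)).1 := by
    intro y hy u
    have e1 : HasMFDerivAt 𝓘(ℝ, E) 𝓘(ℝ, F) (ψ ∘ f) y _ :=
      (dψ y hy).hasMFDerivAt.comp y (df y).hasMFDerivAt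
    have e2 : HasMFDerivAt 𝓘(ℝ, E) 𝓘(ℝ, F) (fun y => (h.equiv (φ y)).1) y _ :=
      ((ContinuousLinearMap.fst ℝ F K ∘L (h.equiv : E →L[ℝ] F × K)).hasMFDerivAt (x := φ y)).comp y
        (dφ y hy).hasMFDerivAt
    have e3 := e1.congr_of_eventuallyEq (f₁ := fun y => (h.equiv (φ y)).1)
      (by filter_upwards [φ.open_source.mem_nhds hy] with y hy; exact (hback y hy).symm)
    exact (congrArg (fun (A : E →L[ℝ] F) => A (u : E)) (hasMFDerivAt_unique e2 e3)).symm
  have ψinj : ∀ y ∈ φ.source, ∀ u : TangentSpace 𝓘(ℝ, F) (f y),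
      mfderiv 𝓘(ℝ, F) 𝓘(ℝ, F) ψ (f y) u = 0 → u = 0 := by
    intro y hy u hu
    have c := (dψs y hy).hasMFDerivAt.comp (f y) (dψ y hy).hasMFDerivAt
    have c2 := (hasMFDerivAt_id (I := 𝓘(ℝ, F)) (f y)).congr_of_eventuallyEq (f₁ := ψ.symm ∘ ψ)
      (by filter_upwards [ψ.open_source.mem_nhds (h.source_subset_preimage_source hy)] with z hz
          simp [hz])
    have e := congrArg (fun (A : F →L[ℝ] F) => A (u : F)) (hasMFDerivAt_unique c c2)
    have e' : mfderiv 𝓘(ℝ, F) 𝓘(ℝ, F) ψ.symm (ψ (f y)) (mfderiv 𝓘(ℝ, F) 𝓘(ℝ, F) ψ (f y) u) =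
      (u : F) := e
    rw [hu] at e'
    exact e'.symm.trans (map_zero _)
  let w : E := mfderiv 𝓘(ℝ, E) 𝓘(ℝ, E) φ x v
  have hw0 : (h.equiv w).1 = 0 := by
    refine (tang x hxs v).symm.trans ?_
    rw [hv]
    exact map_zero _
  let X₀ : ∀ g : G, TangentSpace 𝓘(ℝ, E) g :=
    VectorField.mpullback 𝓘(ℝ, E) 𝓘(ℝ, E) φ (fun _ => w)
  have hX₀ : ∀ y ∈ φ.source, mfderiv 𝓘(ℝ, E) 𝓘(ℝ, E) φ y (X₀ y) = w := fun y hy =>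
    (hinv y hy).self_apply_inverse _
  obtain ⟨χ, hχ, -⟩ := (SmoothBumpFunction.nhds_basis_support (I := 𝓘(ℝ, E)) (c := x)
    (φ.open_source.mem_nhds hxs)).mem_iff.1 (Filter.univ_mem (f := 𝓝 x))
  refine ⟨(χ : G → ℝ) • X₀, ?_, ?_, ?_⟩
  · intro g
    by_cases hg : g ∈ φ.source
    · have : mfderiv 𝓘(ℝ, E) 𝓘(ℝ, F) f g (X₀ g) = 0 := by
        refine ψinj g hg _ ((tang g hg _).trans ?_)
        rw [hX₀ g hg, hw0]
        rfl
      refine (map_smul _ _ _).trans ?_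
      rw [this, smul_zero]
    · have : χ g = 0 := image_eq_zero_of_notMem_tsupport fun h' => hg (hχ h')
      show mfderiv 𝓘(ℝ, E) 𝓘(ℝ, F) f g (χ g • X₀ g) = 0
      rw [this, zero_smul, map_zero]
  · refine ContMDiffOn.smul_section_of_tsupport χ.contMDiff.contMDiffOn φ.open_source hχ ?_
    intro y hy
    apply ContMDiffAt.contMDiffWithinAt
    refine ContMDiffAt.mpullback_vectorField_preimage (n := ∞) ?_ (cφ y hy) (hinv y hy) (by simp)
    exact (contMDiff_vectorSpace_iff_contDiff (V := fun _ : E => w)).2 contDiff_const _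
  · show χ x • X₀ x = v
    have e : (mfderiv 𝓘(ℝ, E) 𝓘(ℝ, E) φ x).inverse (mfderiv 𝓘(ℝ, E) 𝓘(ℝ, E) φ x v) = v :=
      (hinv x hxs).inverse_apply_self _
    rw [χ.eq_one, one_smul]
    exact e

end VerticalFields

/-- The derivative `v(f)` of a real function `f` in the direction of a tangent vector `v` at `g`,
as a linear form in `v`. -/
noncomputable def vectorDeriv {E G : Type*} [NormedAddCommGroup E] [NormedSpace ℝ E]
    [TopologicalSpace G] [ChartedSpace E G] (f : G → ℝ) (g : G) :
    TangentSpace 𝓘(ℝ, E) g →ₗ[ℝ] ℝ :=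
  (mfderiv 𝓘(ℝ, E) 𝓘(ℝ, ℝ) f g : TangentSpace 𝓘(ℝ, E) g →L[ℝ] ℝ).toLinearMap

/-- A Lie groupoid `G ⇉ M` with source `src` (`α`) and target `tgt` (`β`). The product `mul g h`
is only meaningful for composable pairs, that is, when `tgt g = src h`; its values elsewhere are
arbitrary and no condition is put on them. The set of composable pairs is a closed submanifold of
`G × G`, so smoothness of the multiplication is smoothness on this set. -/
structure LieGroupoid (E F G M : Type*) [NormedAddCommGroup E] [NormedSpace ℝ E]
    [NormedAddCommGroup F] [NormedSpace ℝ F]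
    [TopologicalSpace G] [ChartedSpace E G] [TopologicalSpace M] [ChartedSpace F M] where
  src : G → M
  tgt : G → M
  mul : G → G → G
  one : M → G
  inv : G → G
  src_mul : ∀ g h, tgt g = src h → src (mul g h) = src g
  tgt_mul : ∀ g h, tgt g = src h → tgt (mul g h) = tgt h
  mul_assoc : ∀ g h k, tgt g = src h → tgt h = src k → mul g (mul h k) = mul (mul g h) k
  src_one : ∀ x, src (one x) = x
  tgt_one : ∀ x, tgt (one x) = x
  one_mul : ∀ g, mul (one (src g)) g = g
  mul_one : ∀ g, mul g (one (tgt g)) = g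
  src_inv : ∀ g, src (inv g) = tgt g
  tgt_inv : ∀ g, tgt (inv g) = src g
  inv_mul : ∀ g, mul (inv g) g = one (tgt g)
  mul_inv : ∀ g, mul g (inv g) = one (src g)
  isSubmersion_src : Manifold.IsSubmersion 𝓘(ℝ, E) 𝓘(ℝ, F) ∞ src
  isSubmersion_tgt : Manifold.IsSubmersion 𝓘(ℝ, E) 𝓘(ℝ, F) ∞ tgt
  contMDiffOn_mul : ContMDiffOn (𝓘(ℝ, E).prod 𝓘(ℝ, E)) 𝓘(ℝ, E) ∞
    (fun p : G × G => mul p.1 p.2) {p | tgt p.1 = src p.2}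
  contMDiff_one : ContMDiff 𝓘(ℝ, F) 𝓘(ℝ, E) ∞ one
  contMDiff_inv : ContMDiff 𝓘(ℝ, E) 𝓘(ℝ, E) ∞ inv

namespace LieGroupoid

section Basic

variable {E F G M : Type*} [NormedAddCommGroup E] [NormedSpace ℝ E]
  [NormedAddCommGroup F] [NormedSpace ℝ F]
  [TopologicalSpace G] [ChartedSpace E G] [TopologicalSpace M] [ChartedSpace F M]
  (𝒢 : LieGroupoid E F G M)

/-- The `α`-vertical space `V_g α = ker T_g α`. -/
noncomputable def vertSrc (g : G) : Submodule ℝ (TangentSpace 𝓘(ℝ, E) g) :=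
  (mfderiv 𝓘(ℝ, E) 𝓘(ℝ, F) 𝒢.src g).ker

/-- The `β`-vertical space `V_g β = ker T_g β`. -/
noncomputable def vertTgt (g : G) : Submodule ℝ (TangentSpace 𝓘(ℝ, E) g) :=
  (mfderiv 𝓘(ℝ, E) 𝓘(ℝ, F) 𝒢.tgt g).ker

/-- The fibre `A_x G = V_{ε(x)} α` of the Lie algebroid of `G`. -/
noncomputable abbrev algebroidFiber (x : M) : Submodule ℝ (TangentSpace 𝓘(ℝ, E) (𝒢.one x)) :=
  𝒢.vertSrc (𝒢.one x)

/-- The discrete Euler-Lagrange operator at a composable pair `(g, h)` with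
`β(g) = α(h) = x`: the differential at `ε(x)` of the function `L ∘ l_g + L ∘ r_h ∘ i` on the
`α`-fibre of `x`, as a linear form on `A_x G`. -/
noncomputable def eulerLagrange (L : G → ℝ) (g h : G) (x : M)
    (_hg : 𝒢.tgt g = x) (_hh : 𝒢.src h = x) : Module.Dual ℝ (𝒢.algebroidFiber x) :=
  (mfderivWithin 𝓘(ℝ, E) 𝓘(ℝ, ℝ) (fun k => L (𝒢.mul g k) + L (𝒢.mul (𝒢.inv k) h))
    (𝒢.src ⁻¹' {x}) (𝒢.one x) : TangentSpace 𝓘(ℝ, E) (𝒢.one x) →L[ℝ] ℝ).toLinearMap.domRestrict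
      (𝒢.algebroidFiber x)

/-- The fibre at `g` of the vector bundle `P^τ G = Vβ ⊕ Vα` over `G`. -/
abbrev ProlongationFiber (g : G) : Type _ := 𝒢.vertTgt g × 𝒢.vertSrc g

/-- The anchor `(X_g, Y_g) ↦ X_g + Y_g` of `P^τ G`. -/
noncomputable def anchor (g : G) (z : 𝒢.ProlongationFiber g) : TangentSpace 𝓘(ℝ, E) g :=
  (z.1 : TangentSpace 𝓘(ℝ, E) g) + (z.2 : TangentSpace 𝓘(ℝ, E) g)

variable [IsManifold 𝓘(ℝ, E) ∞ G]

/-- A smooth section of the vector bundle `P^τ G = Vβ ⊕ Vα`. -/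
structure ProlongationSection where
  toFun : ∀ g : G, 𝒢.ProlongationFiber g
  contMDiff_fst : ContMDiff 𝓘(ℝ, E) 𝓘(ℝ, E).tangent ∞
    (fun g => (⟨g, ((toFun g).1 : TangentSpace 𝓘(ℝ, E) g)⟩ : TangentBundle 𝓘(ℝ, E) G))
  contMDiff_snd : ContMDiff 𝓘(ℝ, E) 𝓘(ℝ, E).tangent ∞
    (fun g => (⟨g, ((toFun g).2 : TangentSpace 𝓘(ℝ, E) g)⟩ : TangentBundle 𝓘(ℝ, E) G))

/-- For `β(k) = β(g)`, the tangent map `T_k l_{g k⁻¹} : V_k α → V_g α`; note that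
`(g k⁻¹) k = g`. -/
noncomputable def leftTransport (g k : G) (v : TangentSpace 𝓘(ℝ, E) k) :
    TangentSpace 𝓘(ℝ, E) g :=
  (mfderivWithin 𝓘(ℝ, E) 𝓘(ℝ, E) (fun s => 𝒢.mul (𝒢.mul g (𝒢.inv k)) s)
    (𝒢.src ⁻¹' {𝒢.src k}) k v : E)

/-- For `α(k) = α(g)`, the tangent map `T_k r_{k⁻¹ g} : V_k β → V_g β`; note that
`k (k⁻¹ g) = g`. -/
noncomputable def rightTransport (g k : G) (v : TangentSpace 𝓘(ℝ, E) k) :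
    TangentSpace 𝓘(ℝ, E) g :=
  (mfderivWithin 𝓘(ℝ, E) 𝓘(ℝ, E) (fun s => 𝒢.mul s (𝒢.mul (𝒢.inv k) g))
    (𝒢.tgt ⁻¹' {𝒢.tgt k}) k v : E)

/-- The derivative at `g` of a section `Y` of `Vα` in the direction of `x ∈ V_g β`: along the
`β`-fibre through `g` the spaces `V_k α` are identified with `V_g α` by left translation. The left
invariant vector fields are exactly the sections that are constant along the `β`-fibres. -/
noncomputable def derivAlongTgt (g : G) (x : TangentSpace 𝓘(ℝ, E) g)
    (Y : ∀ k : G, TangentSpace 𝓘(ℝ, E) k) : TangentSpace 𝓘(ℝ, E) g :=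
  (mfderivWithin (M' := E) 𝓘(ℝ, E) 𝓘(ℝ, E) (fun k => 𝒢.leftTransport g k (Y k))
    (𝒢.tgt ⁻¹' {𝒢.tgt g}) g x : E)

/-- The derivative at `g` of a section `X` of `Vβ` in the direction of `y ∈ V_g α`: along the
`α`-fibre through `g` the spaces `V_k β` are identified with `V_g β` by right translation. The right
invariant vector fields are exactly the sections that are constant along the `α`-fibres. -/
noncomputable def derivAlongSrc (g : G) (y : TangentSpace 𝓘(ℝ, E) g)
    (X : ∀ k : G, TangentSpace 𝓘(ℝ, E) k) : TangentSpace 𝓘(ℝ, E) g :=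
  (mfderivWithin (M' := E) 𝓘(ℝ, E) 𝓘(ℝ, E) (fun k => 𝒢.rightTransport g k (X k))
    (𝒢.src ⁻¹' {𝒢.src g}) g y : E)

variable [IsManifold 𝓘(ℝ, F) ∞ M]

theorem leftTransport_mem (g k : G) (hk : 𝒢.tgt k = 𝒢.tgt g) (v : TangentSpace 𝓘(ℝ, E) k)
    (hv : v ∈ 𝒢.vertSrc k) : 𝒢.leftTransport g k v ∈ 𝒢.vertSrc g := by
  have hgk : 𝒢.tgt g = 𝒢.src (𝒢.inv k) := by rw [𝒢.src_inv, hk]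
  have ha : 𝒢.tgt (𝒢.mul g (𝒢.inv k)) = 𝒢.src k := by rw [𝒢.tgt_mul _ _ hgk, 𝒢.tgt_inv]
  have hend : 𝒢.mul (𝒢.mul g (𝒢.inv k)) k = g := by
    rw [← 𝒢.mul_assoc _ _ _ hgk (𝒢.tgt_inv k), 𝒢.inv_mul, hk, 𝒢.mul_one]
  have key := mfderiv_mfderivWithin_fiber_eq_zero 𝒢.isSubmersion_src k v hv
    (fun s => 𝒢.mul (𝒢.mul g (𝒢.inv k)) s) 𝒢.src
    ((𝒢.isSubmersion_src.contMDiff _).mdifferentiableAt (by simp))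
    (𝒢.src (𝒢.mul g (𝒢.inv k))) (fun y hy => 𝒢.src_mul _ _ (ha.trans hy.symm))
  have move : ∀ p : G, p = g → ∀ u : E, (mfderiv 𝓘(ℝ, E) 𝓘(ℝ, F) 𝒢.src p : E →L[ℝ] F) u = 0 →
      (mfderiv 𝓘(ℝ, E) 𝓘(ℝ, F) 𝒢.src g : E →L[ℝ] F) u = 0 := by
    rintro p rfl u hu
    exact hu
  exact move _ hend _ key

theorem rightTransport_mem (g k : G) (hk : 𝒢.src k = 𝒢.src g) (v : TangentSpace 𝓘(ℝ, E) k)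
    (hv : v ∈ 𝒢.vertTgt k) : 𝒢.rightTransport g k v ∈ 𝒢.vertTgt g := by
  have hgk : 𝒢.tgt (𝒢.inv k) = 𝒢.src g := by rw [𝒢.tgt_inv, hk]
  have ha : 𝒢.src (𝒢.mul (𝒢.inv k) g) = 𝒢.tgt k := by rw [𝒢.src_mul _ _ hgk, 𝒢.src_inv]
  have hend : 𝒢.mul k (𝒢.mul (𝒢.inv k) g) = g := by
    rw [𝒢.mul_assoc _ _ _ (𝒢.src_inv k).symm hgk, 𝒢.mul_inv, hk, 𝒢.one_mul]
  have key := mfderiv_mfderivWithin_fiber_eq_zero 𝒢.isSubmersion_tgt k v hv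
    (fun s => 𝒢.mul s (𝒢.mul (𝒢.inv k) g)) 𝒢.tgt
    ((𝒢.isSubmersion_tgt.contMDiff _).mdifferentiableAt (by simp))
    (𝒢.tgt (𝒢.mul (𝒢.inv k) g)) (fun y hy => 𝒢.tgt_mul _ _ (hy.trans ha.symm))
  have move : ∀ p : G, p = g → ∀ u : E, (mfderiv 𝓘(ℝ, E) 𝓘(ℝ, F) 𝒢.tgt p : E →L[ℝ] F) u = 0 →
      (mfderiv 𝓘(ℝ, E) 𝓘(ℝ, F) 𝒢.tgt g : E →L[ℝ] F) u = 0 := by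
    rintro p rfl u hu
    exact hu
  exact move _ hend _ key

theorem derivAlongTgt_mem (g : G) (x : TangentSpace 𝓘(ℝ, E) g) (hx : x ∈ 𝒢.vertTgt g)
    (Y : ∀ k : G, TangentSpace 𝓘(ℝ, E) k) (hY : ∀ k, Y k ∈ 𝒢.vertSrc k) :
    𝒢.derivAlongTgt g x Y ∈ 𝒢.vertSrc g := by
  let P : E →L[ℝ] F := mfderiv 𝓘(ℝ, E) 𝓘(ℝ, F) 𝒢.src g
  have key := mfderiv_mfderivWithin_fiber_eq_zero (E' := E) (G' := E) 𝒢.isSubmersion_tgt g x hx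
    (fun k => (𝒢.leftTransport g k (Y k) : E)) P P.mdifferentiableAt 0
    (fun k hk => 𝒢.leftTransport_mem g k hk _ (hY k))
  exact (congrArg (fun A : E →L[ℝ] F => A _) P.hasMFDerivAt.mfderiv).symm.trans key

theorem derivAlongSrc_mem (g : G) (y : TangentSpace 𝓘(ℝ, E) g) (hy : y ∈ 𝒢.vertSrc g)
    (X : ∀ k : G, TangentSpace 𝓘(ℝ, E) k) (hX : ∀ k, X k ∈ 𝒢.vertTgt k) :
    𝒢.derivAlongSrc g y X ∈ 𝒢.vertTgt g := by
  let P : E →L[ℝ] F := mfderiv 𝓘(ℝ, E) 𝓘(ℝ, F) 𝒢.tgt g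
  have key := mfderiv_mfderivWithin_fiber_eq_zero (E' := E) (G' := E) 𝒢.isSubmersion_src g y hy
    (fun k => (𝒢.rightTransport g k (X k) : E)) P P.mdifferentiableAt 0
    (fun k hk => 𝒢.rightTransport_mem g k hk _ (hX k))
  exact (congrArg (fun A : E →L[ℝ] F => A _) P.hasMFDerivAt.mfderiv).symm.trans key

end Basic

section Differential

variable {E F G M : Type*} [NormedAddCommGroup E] [NormedSpace ℝ E] [FiniteDimensional ℝ E]
  [NormedAddCommGroup F] [NormedSpace ℝ F]
  [TopologicalSpace G] [ChartedSpace E G] [IsManifold 𝓘(ℝ, E) ∞ G]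
  [TopologicalSpace M] [ChartedSpace F M] [IsManifold 𝓘(ℝ, F) ∞ M]
  (𝒢 : LieGroupoid E F G M)

/-- The bracket of the Lie algebroid `P^τ G = Vβ ⊕ Vα`, in the form
`[(X, Y), (X', Y')] = ([X, X'] + ∇_Y X' - ∇_{Y'} X, [Y, Y'] + ∇_X Y' - ∇_{X'} Y)`,
where `∇_Y X'` and `∇_X Y'` are the derivatives of `X'` along the `α`-fibres and of `Y'` along the
`β`-fibres. It satisfies the Leibniz rule for the anchor `(X, Y) ↦ X + Y`. Since right invariant
sections of `Vβ` and left invariant sections of `Vα` have vanishing derivatives `∇`, the bracket of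
`(X, Y)` and `(X', Y')` is `([X, X'], [Y, Y'])` if `X, X'` are right invariant and `Y, Y'` are left
invariant. As these sections generate, the two properties determine the bracket. -/
noncomputable def bracket (Z W : 𝒢.ProlongationSection) (g : G) : 𝒢.ProlongationFiber g :=
  (⟨VectorField.mlieBracket 𝓘(ℝ, E) (fun k => (Z.toFun k).1) (fun k => (W.toFun k).1) g
      + 𝒢.derivAlongSrc g (Z.toFun g).2 (fun k => (W.toFun k).1)
      - 𝒢.derivAlongSrc g (W.toFun g).2 (fun k => (Z.toFun k).1),
    have := FiniteDimensional.complete ℝ E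
    sub_mem (add_mem
      (mfderiv_mlieBracket_eq_zero 𝒢.isSubmersion_tgt.contMDiff _ _
        Z.contMDiff_fst W.contMDiff_fst (fun k => (Z.toFun k).1.2) (fun k => (W.toFun k).1.2) g)
      (𝒢.derivAlongSrc_mem g _ (Z.toFun g).2.2 _ fun k => (W.toFun k).1.2))
      (𝒢.derivAlongSrc_mem g _ (W.toFun g).2.2 _ fun k => (Z.toFun k).1.2)⟩,
   ⟨VectorField.mlieBracket 𝓘(ℝ, E) (fun k => (Z.toFun k).2) (fun k => (W.toFun k).2) g
      + 𝒢.derivAlongTgt g (Z.toFun g).1 (fun k => (W.toFun k).2)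
      - 𝒢.derivAlongTgt g (W.toFun g).1 (fun k => (Z.toFun k).2),
    have := FiniteDimensional.complete ℝ E
    sub_mem (add_mem
      (mfderiv_mlieBracket_eq_zero 𝒢.isSubmersion_src.contMDiff _ _
        Z.contMDiff_snd W.contMDiff_snd (fun k => (Z.toFun k).2.2) (fun k => (W.toFun k).2.2) g)
      (𝒢.derivAlongTgt_mem g _ (Z.toFun g).1.2 _ fun k => (W.toFun k).2.2))
      (𝒢.derivAlongTgt_mem g _ (W.toFun g).1.2 _ fun k => (Z.toFun k).2.2)⟩)

/-- The defining property of the bracket on invariant sections: for right invariant `X, X'` and left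
invariant `Y, Y'` one has `[(X, Y), (X', Y')] = ([X, X'], [Y, Y'])`. -/
theorem bracket_of_invariant (Z W : 𝒢.ProlongationSection)
    (hZ₁ : ∀ g k, 𝒢.src k = 𝒢.src g → 𝒢.rightTransport g k (Z.toFun k).1 = (Z.toFun g).1)
    (hW₁ : ∀ g k, 𝒢.src k = 𝒢.src g → 𝒢.rightTransport g k (W.toFun k).1 = (W.toFun g).1)
    (hZ₂ : ∀ g k, 𝒢.tgt k = 𝒢.tgt g → 𝒢.leftTransport g k (Z.toFun k).2 = (Z.toFun g).2)
    (hW₂ : ∀ g k, 𝒢.tgt k = 𝒢.tgt g → 𝒢.leftTransport g k (W.toFun k).2 = (W.toFun g).2)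
    (g : G) :
    ((𝒢.bracket Z W g).1 : TangentSpace 𝓘(ℝ, E) g) = VectorField.mlieBracket 𝓘(ℝ, E)
        (fun k => (Z.toFun k).1) (fun k => (W.toFun k).1) g ∧
    ((𝒢.bracket Z W g).2 : TangentSpace 𝓘(ℝ, E) g) = VectorField.mlieBracket 𝓘(ℝ, E)
        (fun k => (Z.toFun k).2) (fun k => (W.toFun k).2) g := by
  have h1 : ∀ (X : ∀ k : G, TangentSpace 𝓘(ℝ, E) k) (y : TangentSpace 𝓘(ℝ, E) g),
      (∀ k, 𝒢.src k = 𝒢.src g → 𝒢.rightTransport g k (X k) = X g) →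
      𝒢.derivAlongSrc g y X = 0 := by
    intro X y hX
    have e := mfderivWithin_congr (I := 𝓘(ℝ, E)) (I' := 𝓘(ℝ, E)) (M' := E)
      (s := 𝒢.src ⁻¹' {𝒢.src g}) (x := g) (f := fun _ : G => (X g : E))
      (f₁ := fun k => (𝒢.rightTransport g k (X k) : E)) (fun k hk => hX k hk) (hX g rfl)
    refine (congrArg (fun A : E →L[ℝ] E => A (y : E)) e).trans ?_
    exact congrArg (fun A : E →L[ℝ] E => A (y : E)) mfderivWithin_const
  have h2 : ∀ (Y : ∀ k : G, TangentSpace 𝓘(ℝ, E) k) (x : TangentSpace 𝓘(ℝ, E) g),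
      (∀ k, 𝒢.tgt k = 𝒢.tgt g → 𝒢.leftTransport g k (Y k) = Y g) →
      𝒢.derivAlongTgt g x Y = 0 := by
    intro Y x hY
    have e := mfderivWithin_congr (I := 𝓘(ℝ, E)) (I' := 𝓘(ℝ, E)) (M' := E)
      (s := 𝒢.tgt ⁻¹' {𝒢.tgt g}) (x := g) (f := fun _ : G => (Y g : E))
      (f₁ := fun k => (𝒢.leftTransport g k (Y k) : E)) (fun k hk => hY k hk) (hY g rfl)
    refine (congrArg (fun A : E →L[ℝ] E => A (x : E)) e).trans ?_
    exact congrArg (fun A : E →L[ℝ] E => A (x : E)) mfderivWithin_const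
  constructor
  · simp only [bracket]
    rw [h1 _ _ (hW₁ g), h1 _ _ (hZ₁ g), add_zero, sub_zero]
  · simp only [bracket]
    rw [h2 _ _ (hW₂ g), h2 _ _ (hZ₂ g), add_zero, sub_zero]

/-- `dμ(Z, W) = ρ(Z)(μ(W)) - ρ(W)(μ(Z)) - μ([Z, W])` for smooth sections `Z`, `W` of `P^τ G` and a
section `μ` of its dual. -/
noncomputable def differentialOn (μ : ∀ g : G, Module.Dual ℝ (𝒢.ProlongationFiber g))
    (Z W : 𝒢.ProlongationSection) (g : G) : ℝ :=
  vectorDeriv (fun k => μ k (W.toFun k)) g (𝒢.anchor g (Z.toFun g))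
    - vectorDeriv (fun k => μ k (Z.toFun k)) g (𝒢.anchor g (W.toFun g))
    - μ g (𝒢.bracket Z W g)

theorem exists_section_through [T2Space G] (g : G) (z : 𝒢.ProlongationFiber g) :
    ∃ Z : 𝒢.ProlongationSection, Z.toFun g = z := by
  obtain ⟨X, hX, hXs, hXg⟩ :=
    exists_smooth_vertical_field 𝒢.isSubmersion_tgt g z.1.1 z.1.2
  obtain ⟨Y, hY, hYs, hYg⟩ :=
    exists_smooth_vertical_field 𝒢.isSubmersion_src g z.2.1 z.2.2
  exact ⟨⟨fun k => (⟨X k, hX k⟩, ⟨Y k, hY k⟩), hXs, hYs⟩,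
    Prod.ext (Subtype.ext hXg) (Subtype.ext hYg)⟩

/-- The differential `dμ` of a section `μ` of the dual of `P^τ G`, as a 2-section: its value at
`z, w` in the fibre over `g` is `dμ(Z, W)(g)` for smooth sections `Z`, `W` with `Z(g) = z` and
`W(g) = w`. (For smooth `μ` the number `dμ(Z, W)(g)` only depends on `Z(g)` and `W(g)`.) -/
noncomputable def differential [T2Space G] (μ : ∀ g : G, Module.Dual ℝ (𝒢.ProlongationFiber g))
    (g : G) (z w : 𝒢.ProlongationFiber g) : ℝ :=
  𝒢.differentialOn μ (𝒢.exists_section_through g z).choose (𝒢.exists_section_through g w).choose g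

/-- The Poincaré-Cartan 1-section `Θ_L⁺(g)(X_g, Y_g) = Y_g(L)`. -/
noncomputable def thetaPlus (L : G → ℝ) (g : G) : Module.Dual ℝ (𝒢.ProlongationFiber g) :=
  vectorDeriv L g ∘ₗ (𝒢.vertSrc g).subtype ∘ₗ LinearMap.snd ℝ (𝒢.vertTgt g) (𝒢.vertSrc g)

/-- The Poincaré-Cartan 1-section `Θ_L⁻(g)(X_g, Y_g) = -X_g(L)`. -/
noncomputable def thetaMinus (L : G → ℝ) (g : G) : Module.Dual ℝ (𝒢.ProlongationFiber g) :=
  -(vectorDeriv L g ∘ₗ (𝒢.vertTgt g).subtype ∘ₗ LinearMap.fst ℝ (𝒢.vertTgt g) (𝒢.vertSrc g))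

/-- The Poincaré-Cartan 2-section `Ω_L = -dΘ_L⁺` (which is also `-dΘ_L⁻`). -/
noncomputable def omega [T2Space G] (L : G → ℝ) (g : G) (z w : 𝒢.ProlongationFiber g) : ℝ :=
  -𝒢.differential (𝒢.thetaPlus L) g z w

end Differential

end LieGroupoid

/-- A morphism of Lie groupoids: a smooth map that preserves composable pairs and products. -/
structure LieGroupoidMorphism {E F G M E' F' G' M' : Type*}
    [NormedAddCommGroup E] [NormedSpace ℝ E] [NormedAddCommGroup F] [NormedSpace ℝ F]
    [TopologicalSpace G] [ChartedSpace E G] [TopologicalSpace M] [ChartedSpace F M]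
    [NormedAddCommGroup E'] [NormedSpace ℝ E'] [NormedAddCommGroup F'] [NormedSpace ℝ F']
    [TopologicalSpace G'] [ChartedSpace E' G'] [TopologicalSpace M'] [ChartedSpace F' M']
    (𝒢 : LieGroupoid E F G M) (𝒢' : LieGroupoid E' F' G' M') where
  toFun : G → G'
  contMDiff_toFun : ContMDiff 𝓘(ℝ, E) 𝓘(ℝ, E') ∞ toFun
  composable : ∀ g h, 𝒢.tgt g = 𝒢.src h → 𝒢'.tgt (toFun g) = 𝒢'.src (toFun h)
  map_mul : ∀ g h, 𝒢.tgt g = 𝒢.src h → toFun (𝒢.mul g h) = 𝒢'.mul (toFun g) (toFun h)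

namespace LieGroupoidMorphism

variable {E F G M E' F' G' M' : Type*}
  [NormedAddCommGroup E] [NormedSpace ℝ E] [NormedAddCommGroup F] [NormedSpace ℝ F]
  [TopologicalSpace G] [ChartedSpace E G] [TopologicalSpace M] [ChartedSpace F M]
  [NormedAddCommGroup E'] [NormedSpace ℝ E'] [NormedAddCommGroup F'] [NormedSpace ℝ F']
  [TopologicalSpace G'] [ChartedSpace E' G'] [TopologicalSpace M'] [ChartedSpace F' M']
  {𝒢 : LieGroupoid E F G M} {𝒢' : LieGroupoid E' F' G' M'}

/-- The induced map `Φ₀ : M → M'` on the bases. -/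
def base (Φ : LieGroupoidMorphism 𝒢 𝒢') (x : M) : M' := 𝒢'.src (Φ.toFun (𝒢.one x))

theorem tgt_toFun_one (Φ : LieGroupoidMorphism 𝒢 𝒢') (x : M) :
    𝒢'.tgt (Φ.toFun (𝒢.one x)) = Φ.base x :=
  Φ.composable _ _ (by rw [𝒢.tgt_one, 𝒢.src_one])

theorem src_toFun (Φ : LieGroupoidMorphism 𝒢 𝒢') (g : G) :
    𝒢'.src (Φ.toFun g) = Φ.base (𝒢.src g) := by
  rw [← Φ.tgt_toFun_one, Φ.composable _ g (𝒢.tgt_one _)]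

theorem tgt_toFun (Φ : LieGroupoidMorphism 𝒢 𝒢') (g : G) :
    𝒢'.tgt (Φ.toFun g) = Φ.base (𝒢.tgt g) :=
  Φ.composable g _ (𝒢.src_one _).symm

theorem toFun_one (Φ : LieGroupoidMorphism 𝒢 𝒢') (x : M) :
    Φ.toFun (𝒢.one x) = 𝒢'.one (Φ.base x) := by
  have hc : 𝒢.tgt (𝒢.one x) = 𝒢.src (𝒢.one x) := by rw [𝒢.tgt_one, 𝒢.src_one]
  have h1 : 𝒢.mul (𝒢.one x) (𝒢.one x) = 𝒢.one x := by
    have := 𝒢.mul_one (𝒢.one x)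
    rwa [𝒢.tgt_one] at this
  have h2 := Φ.map_mul _ _ hc
  rw [h1] at h2
  have h3 := 𝒢'.mul_assoc (𝒢'.inv (Φ.toFun (𝒢.one x))) _ _ (𝒢'.tgt_inv _)
    (Φ.composable _ _ hc)
  rw [← h2, 𝒢'.inv_mul, Φ.composable _ _ hc, 𝒢'.one_mul] at h3
  exact h3.symm

theorem contMDiff_base (Φ : LieGroupoidMorphism 𝒢 𝒢') :
    ContMDiff 𝓘(ℝ, F) 𝓘(ℝ, F') ∞ Φ.base :=
  (𝒢'.isSubmersion_src.contMDiff).comp (Φ.contMDiff_toFun.comp 𝒢.contMDiff_one)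

theorem mfderiv_mem_vertSrc (Φ : LieGroupoidMorphism 𝒢 𝒢') (g : G) (v : TangentSpace 𝓘(ℝ, E) g)
    (hv : v ∈ 𝒢.vertSrc g) :
    mfderiv 𝓘(ℝ, E) 𝓘(ℝ, E') Φ.toFun g v ∈ 𝒢'.vertSrc (Φ.toFun g) := by
  have hv' : mfderiv 𝓘(ℝ, E) 𝓘(ℝ, F) 𝒢.src g v = 0 := hv
  have h1 := (((𝒢'.isSubmersion_src.contMDiff) (Φ.toFun g)).mdifferentiableAt
    (by simp)).hasMFDerivAt.comp g ((Φ.contMDiff_toFun g).mdifferentiableAt (by simp)).hasMFDerivAt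
  have h2 := ((Φ.contMDiff_base (𝒢.src g)).mdifferentiableAt
    (by simp)).hasMFDerivAt.comp g
      ((𝒢.isSubmersion_src.contMDiff g).mdifferentiableAt (by simp)).hasMFDerivAt
  have e : 𝒢'.src ∘ Φ.toFun = Φ.base ∘ 𝒢.src := funext Φ.src_toFun
  rw [e] at h1
  have h3 := congrArg (fun (A : E →L[ℝ] F') => A (v : E)) (hasMFDerivAt_unique h1 h2)
  refine Eq.trans h3 ?_
  show mfderiv 𝓘(ℝ, F) 𝓘(ℝ, F') Φ.base (𝒢.src g) (mfderiv 𝓘(ℝ, E) 𝓘(ℝ, F) 𝒢.src g v) = 0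
  rw [hv', map_zero]

theorem mfderiv_mem_vertTgt (Φ : LieGroupoidMorphism 𝒢 𝒢') (g : G) (v : TangentSpace 𝓘(ℝ, E) g)
    (hv : v ∈ 𝒢.vertTgt g) :
    mfderiv 𝓘(ℝ, E) 𝓘(ℝ, E') Φ.toFun g v ∈ 𝒢'.vertTgt (Φ.toFun g) := by
  have hv' : mfderiv 𝓘(ℝ, E) 𝓘(ℝ, F) 𝒢.tgt g v = 0 := hv
  have h1 := (((𝒢'.isSubmersion_tgt.contMDiff) (Φ.toFun g)).mdifferentiableAt
    (by simp)).hasMFDerivAt.comp g ((Φ.contMDiff_toFun g).mdifferentiableAt (by simp)).hasMFDerivAt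
  have h2 := ((Φ.contMDiff_base (𝒢.tgt g)).mdifferentiableAt
    (by simp)).hasMFDerivAt.comp g
      ((𝒢.isSubmersion_tgt.contMDiff g).mdifferentiableAt (by simp)).hasMFDerivAt
  have e : 𝒢'.tgt ∘ Φ.toFun = Φ.base ∘ 𝒢.tgt := funext Φ.tgt_toFun
  rw [e] at h1
  have h3 := congrArg (fun (A : E →L[ℝ] F') => A (v : E)) (hasMFDerivAt_unique h1 h2)
  refine Eq.trans h3 ?_
  show mfderiv 𝓘(ℝ, F) 𝓘(ℝ, F') Φ.base (𝒢.tgt g) (mfderiv 𝓘(ℝ, E) 𝓘(ℝ, F) 𝒢.tgt g v) = 0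
  rw [hv', map_zero]

/-- The linear map `A_x Φ : A_x G → A_{Φ₀(x)} G'`, the restriction of `T_{ε(x)} Φ`; note that
`Φ(ε(x)) = ε'(Φ₀(x))`. -/
noncomputable def algebroidMap (Φ : LieGroupoidMorphism 𝒢 𝒢') (x : M) :
    𝒢.algebroidFiber x →ₗ[ℝ] 𝒢'.algebroidFiber (Φ.base x) :=
  (mfderiv 𝓘(ℝ, E) 𝓘(ℝ, E') Φ.toFun (𝒢.one x) :
      TangentSpace 𝓘(ℝ, E) (𝒢.one x) →L[ℝ]
        TangentSpace 𝓘(ℝ, E') (𝒢'.one (Φ.base x))).toLinearMap.restrict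
    (fun v hv => by
      have move : ∀ p : G', Φ.toFun (𝒢.one x) = p → ∀ u : E', 
          (mfderiv 𝓘(ℝ, E') 𝓘(ℝ, F') 𝒢'.src (Φ.toFun (𝒢.one x)) : E' →L[ℝ] F') u = 0 →
          (mfderiv 𝓘(ℝ, E') 𝓘(ℝ, F') 𝒢'.src p : E' →L[ℝ] F') u = 0 := by
        rintro p rfl u hu
        exact hu
      exact move _ (Φ.toFun_one x) _ (Φ.mfderiv_mem_vertSrc _ v hv))

/-- The prolongation `P^τ_g Φ (V, W) = (T_g Φ V, T_g Φ W)`. -/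
noncomputable def prolongation (Φ : LieGroupoidMorphism 𝒢 𝒢') (g : G) :
    𝒢.ProlongationFiber g →ₗ[ℝ] 𝒢'.ProlongationFiber (Φ.toFun g) :=
  ((mfderiv 𝓘(ℝ, E) 𝓘(ℝ, E') Φ.toFun g).toLinearMap.restrict (Φ.mfderiv_mem_vertTgt g)).prodMap
    ((mfderiv 𝓘(ℝ, E) 𝓘(ℝ, E') Φ.toFun g).toLinearMap.restrict (Φ.mfderiv_mem_vertSrc g))

/-- The pullback `(P^τΦ, Φ)^* μ'` of a 1-section. -/
noncomputable def pullbackOne (Φ : LieGroupoidMorphism 𝒢 𝒢')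
    (μ' : ∀ g' : G', Module.Dual ℝ (𝒢'.ProlongationFiber g')) (g : G) :
    Module.Dual ℝ (𝒢.ProlongationFiber g) :=
  μ' (Φ.toFun g) ∘ₗ Φ.prolongation g

/-- The pullback `(P^τΦ, Φ)^* ω'` of a 2-section. -/
noncomputable def pullbackTwo (Φ : LieGroupoidMorphism 𝒢 𝒢')
    (ω' : ∀ g' : G', 𝒢'.ProlongationFiber g' → 𝒢'.ProlongationFiber g' → ℝ) (g : G)
    (z w : 𝒢.ProlongationFiber g) : ℝ :=
  ω' (Φ.toFun g) (Φ.prolongation g z) (Φ.prolongation g w)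

end LieGroupoidMorphism

/-! Every object in the theorem can be computed by differentiating `L` along curves that stay in
fibres of `α` or `β`. A morphism sends such curves to curves of the same kind, carries velocities by
its tangent map and preserves products and inverses, so it preserves the resulting numbers. For `Θ⁺`
and `Θ⁻` this is just the chain rule. For the Euler-Lagrange operator, a curve `c` in the `α`-fibre
of `x` with velocity `v` at `ε(x)` gives the derivative of `L(g c(s)) + L(c(s)⁻¹ h)`, and `Φ ∘ c`
gives the same function for `L'` (`eulerLagrange_comp`).

The substance is in `Ω`. The sections extending two vectors on `G` and their images on `G'` are
chosen independently and are related by `Φ` only at the one point, so naturality of brackets is not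
available. Instead `dΘ⁺` is made pointwise. For `Z = (X, Y)` and `W = (X', Y')` the terms `Y(Y'(L))
- Y'(Y(L))` cancel against `[Y, Y'](L)` (`vectorDeriv_mlieBracket`), leaving `B(X, Y') - B(X', Y)`
with `B(x, Y) = x(Y(L)) - (∇_x Y)(L)` (`differentialOn_thetaPlus`).

By `hasDerivAt_deriv_mul`, `B(x, Y)` is the mixed second derivative at `0` of `L(γ(t) g⁻¹ η(s))`,
where `γ` lies in the `β`-fibre with velocity `x` and `η` in the `α`-fibre with velocity `Y(g)`. The
reason is the product rule: `Y(L)` along `γ` is the differential at `g` of `m ↦ L(γ(t) g⁻¹ m)`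
applied to the left-transported value of `Y`; `∇_x Y` accounts for the derivative of the second
factor, and `B` for that of the first. This description sees only velocities at `g` and is visibly
natural.

Most of the analysis is there to justify the product rule. Translations live only on fibres, so they
are first extended to smooth families on open sets (`exists_fiber_projection`,
`exists_local_translations`). -/

/-! ### Derivatives along the fibres of a submersion. -/

section FiberCalculus

open Set Filter Manifold

variable {E F E' : Type*} [NormedAddCommGroup E] [NormedSpace ℝ E]
  [NormedAddCommGroup F] [NormedSpace ℝ F] [NormedAddCommGroup E'] [NormedSpace ℝ E']
  {G M G' : Type*} [TopologicalSpace G] [ChartedSpace E G]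
  [TopologicalSpace M] [ChartedSpace F M]
  [TopologicalSpace G'] [ChartedSpace E' G']

/-- The chain rule along a curve that stays in a set. -/
theorem HasMFDerivWithinAt.comp_curve {Φ : G → G'} {s : Set G} {γ : ℝ → G} {x : G} (hx : γ 0 = x)
    {A : E →L[ℝ] E'} (hΦ : HasMFDerivWithinAt 𝓘(ℝ, E) 𝓘(ℝ, E') Φ s x A) {v : E}
    (hγ : HasMFDerivAt 𝓘(ℝ, ℝ) 𝓘(ℝ, E) γ 0
      (ContinuousLinearMap.toSpanSingleton ℝ v : ℝ →L[ℝ] E))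
    (hs : ∀ᶠ t in 𝓝 (0 : ℝ), γ t ∈ s) :
    HasMFDerivAt 𝓘(ℝ, ℝ) 𝓘(ℝ, E') (Φ ∘ γ) 0
      (ContinuousLinearMap.toSpanSingleton ℝ (A v) : ℝ →L[ℝ] E') := by
  subst hx
  -- The set of times spent in `s` is a neighbourhood of `0`, so the derivative within it is a full
  -- derivative.
  have h1 := (hΦ.comp (0 : ℝ) hγ.hasMFDerivWithinAt (s := {t | γ t ∈ s})
    (fun t ht => ht)).hasMFDerivAt hs
  refine h1.congr_mfderiv ?_
  refine ContinuousLinearMap.ext_ring ?_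
  show A ((1 : ℝ) • v) = (1 : ℝ) • A v
  rw [one_smul, one_smul]

theorem HasMFDerivAt.comp_curve {Φ : G → G'} {γ : ℝ → G} {x : G} (hx : γ 0 = x)
    {A : E →L[ℝ] E'} (hΦ : HasMFDerivAt 𝓘(ℝ, E) 𝓘(ℝ, E') Φ x A) {v : E}
    (hγ : HasMFDerivAt 𝓘(ℝ, ℝ) 𝓘(ℝ, E) γ 0
      (ContinuousLinearMap.toSpanSingleton ℝ v : ℝ →L[ℝ] E)) :
    HasMFDerivAt 𝓘(ℝ, ℝ) 𝓘(ℝ, E') (Φ ∘ γ) 0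
      (ContinuousLinearMap.toSpanSingleton ℝ (A v) : ℝ →L[ℝ] E') :=
  (hasMFDerivWithinAt_univ.2 hΦ).comp_curve hx hγ (by simp)

/-- The velocity of a curve in a normed space. -/
theorem HasMFDerivAt.hasDerivAt_curve {c : ℝ → E} {v : E}
    (h : HasMFDerivAt 𝓘(ℝ, ℝ) 𝓘(ℝ, E) c 0
      (ContinuousLinearMap.toSpanSingleton ℝ v : ℝ →L[ℝ] E)) : HasDerivAt c v 0 := by
  have h' : HasFDerivAt c (ContinuousLinearMap.toSpanSingleton ℝ v) 0 := h.hasFDerivAt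
  simpa using h'.hasDerivAt

/-- Near a point, a submersion `f` admits a smooth family of projections `S (k, ·)` onto
its fibres `f ⁻¹' {f k}`. -/
theorem exists_fiber_projection {f : G → M} (hf : IsSubmersion 𝓘(ℝ, E) 𝓘(ℝ, F) ∞ f) (g : G) :
    ∃ S : G × G → G, ContMDiffAt (𝓘(ℝ, E).prod 𝓘(ℝ, E)) 𝓘(ℝ, E) ∞ S (g, g) ∧
      S (g, g) = g ∧
      ∀ᶠ p in 𝓝 (g, g), f (S p) = f p.1 ∧ (f p.2 = f p.1 → S p = p.2) := by
  obtain ⟨K, _, _, h⟩ := hf.isSubmersionAt g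
  set φ := h.domChart with hφ
  set ψ := h.codChart with hψ
  have hxs : g ∈ φ.source := h.mem_domChart_source
  have hφm := h.domChart_mem_maximalAtlas
  have heq := h.writtenInCharts
  simp only [mfld_simps] at heq
  have hback : ∀ y ∈ φ.source, ψ (f y) = (h.equiv (φ y)).1 := by
    intro y hy
    have e := heq (φ.map_source hy)
    have e' : ψ (f (φ.symm (φ y))) = (h.equiv (φ y)).1 := e
    rwa [φ.left_inv hy] at e'
  -- In the adapted charts `f` is the projection `F × K → F`: keep the `K`-coordinate of the second
  -- point and take the `F`-coordinate, which fixes the fibre, from the first.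
  let q : G × G → E := fun p => h.equiv.symm ((h.equiv (φ p.1)).1, (h.equiv (φ p.2)).2)
  have hqg : q (g, g) = φ g := by simp [q]
  have cφ : ContMDiffAt 𝓘(ℝ, E) 𝓘(ℝ, E) ∞ φ g := contMDiffAt_of_mem_maximalAtlas hφm hxs
  have cφs : ContMDiffAt 𝓘(ℝ, E) 𝓘(ℝ, E) ∞ φ.symm (q (g, g)) := by
    rw [hqg]; exact contMDiffAt_symm_of_mem_maximalAtlas hφm (φ.map_source hxs)
  let Λ : E × E →L[ℝ] E := (h.equiv.symm : F × K →L[ℝ] E) ∘L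
    (((ContinuousLinearMap.fst ℝ F K) ∘L (h.equiv : E →L[ℝ] F × K)).prodMap
      ((ContinuousLinearMap.snd ℝ F K) ∘L (h.equiv : E →L[ℝ] F × K)))
  have cq : ContMDiffAt (𝓘(ℝ, E).prod 𝓘(ℝ, E)) 𝓘(ℝ, E) ∞ q (g, g) := by
    have c1 : ContMDiffAt (𝓘(ℝ, E).prod 𝓘(ℝ, E)) 𝓘(ℝ, E) ∞ (fun p : G × G => φ p.1) (g, g) :=
      ContMDiffAt.comp (g, g) (g := φ) (f := Prod.fst) cφ contMDiffAt_fst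
    have c2 : ContMDiffAt (𝓘(ℝ, E).prod 𝓘(ℝ, E)) 𝓘(ℝ, E) ∞ (fun p : G × G => φ p.2) (g, g) :=
      ContMDiffAt.comp (g, g) (g := φ) (f := Prod.snd) cφ contMDiffAt_snd
    exact ContMDiffAt.comp (g, g) (g := Λ) (Λ.contDiff.contMDiff _) (c1.prodMk_space c2)
  refine ⟨fun p => φ.symm (q p), cφs.comp (g, g) cq, by simp [hqg, hxs], ?_⟩
  have ev1 : ∀ᶠ p in 𝓝 (g, g), q p ∈ φ.target :=
    cq.continuousAt.eventually (by
      rw [hqg]; exact φ.open_target.mem_nhds (φ.map_source hxs))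
  have ev2 : ∀ᶠ p : G × G in 𝓝 (g, g), p.1 ∈ φ.source :=
    continuousAt_fst.eventually (φ.open_source.mem_nhds hxs)
  have ev3 : ∀ᶠ p : G × G in 𝓝 (g, g), p.2 ∈ φ.source :=
    continuousAt_snd.eventually (φ.open_source.mem_nhds hxs)
  filter_upwards [ev1, ev2, ev3] with p h1 h2 h3
  constructor
  · have hs := φ.map_target h1
    apply ψ.injOn (h.source_subset_preimage_source hs) (h.source_subset_preimage_source h2)
    rw [hback _ hs, hback _ h2, φ.right_inv h1]
    simp [q]
  · intro hfp
    have : (h.equiv (φ p.1)).1 = (h.equiv (φ p.2)).1 := by rw [← hback _ h2, ← hback _ h3, hfp]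
    show φ.symm (h.equiv.symm ((h.equiv (φ p.1)).1, (h.equiv (φ p.2)).2)) = p.2
    rw [this]
    simp [h3]

variable [IsManifold 𝓘(ℝ, E) ∞ G] [IsManifold 𝓘(ℝ, F) ∞ M]

/-- Two derivatives of a map along the fibre of a submersion agree on vertical vectors. -/
theorem HasMFDerivWithinAt.eq_on_vertical {f : G → M}
    (hf : IsSubmersion 𝓘(ℝ, E) 𝓘(ℝ, F) ∞ f) {x : G} {Φ : G → G'} {A B : E →L[ℝ] E'}
    (hA : HasMFDerivWithinAt 𝓘(ℝ, E) 𝓘(ℝ, E') Φ (f ⁻¹' {f x}) x A)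
    (hB : HasMFDerivWithinAt 𝓘(ℝ, E) 𝓘(ℝ, E') Φ (f ⁻¹' {f x}) x B)
    (v : TangentSpace 𝓘(ℝ, E) x) (hv : mfderiv 𝓘(ℝ, E) 𝓘(ℝ, F) f x v = 0) :
    A (v : E) = B (v : E) := by
  -- A fibre need not have unique derivatives as a subset of `G`; uniqueness is borrowed from `ℝ` by
  -- testing on a curve in the fibre.
  obtain ⟨γ, h0, hγ, hfib⟩ := exists_curve_in_fiber hf x v hv
  have := hasMFDerivAt_unique (hA.comp_curve h0 hγ hfib) (hB.comp_curve h0 hγ hfib)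
  have := congrArg (fun (A : ℝ →L[ℝ] E') => A 1) this
  have h5 : (1 : ℝ) • A v = (1 : ℝ) • B v := this
  rwa [one_smul, one_smul] at h5

end FiberCalculus

/-! ### Vector fields as derivations of functions. -/

section Functions

open Set Filter Manifold Bundle

variable {E : Type*} [NormedAddCommGroup E] [NormedSpace ℝ E]
  {G : Type*} [TopologicalSpace G] [ChartedSpace E G] [IsManifold 𝓘(ℝ, E) ∞ G]

/-- The coordinate change from a chart to itself is the identity. The equality of base points is
only propositional in the application, where it comes from `(g k⁻¹) k = g`. -/
theorem TangentBundle.trivializationAt_apply_snd_of_eq {p q : G} (hpq : p = q)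
    (v : TangentSpace 𝓘(ℝ, E) p) :
    (trivializationAt E (TangentSpace 𝓘(ℝ, E)) q ⟨p, v⟩).2 = (v : E) := by
  have : IsManifold 𝓘(ℝ, E) 1 G := IsManifold.of_le (n := ∞) (by exact_mod_cast le_top)
  subst hpq
  rw [TangentBundle.trivializationAt_apply]
  exact (tangentBundleCore 𝓘(ℝ, E) G).coordChange_self (achart E p) p
    (mem_chart_source E p) v

/-- The derivative of a smooth function along a smooth vector field is smooth. -/
theorem contMDiff_vectorDeriv {L : G → ℝ} (hL : ContMDiff 𝓘(ℝ, E) 𝓘(ℝ, ℝ) ∞ L)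
    {V : ∀ g : G, TangentSpace 𝓘(ℝ, E) g}
    (hV : ContMDiff 𝓘(ℝ, E) 𝓘(ℝ, E).tangent ∞ (fun g => (⟨g, V g⟩ : TangentBundle 𝓘(ℝ, E) G))) :
    ContMDiff 𝓘(ℝ, E) 𝓘(ℝ, ℝ) ∞ (fun k => vectorDeriv L k (V k)) := by
  have : IsManifold 𝓘(ℝ, E) 1 G := IsManifold.of_le (n := ∞) (by exact_mod_cast le_top)
  have h1 := (hL.contMDiff_tangentMap (m := ∞) (by simp)).comp hV
  exact (contMDiff_snd_tangentBundle_modelSpace ℝ 𝓘(ℝ, ℝ)).comp h1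

/-- The Lie bracket of vector fields acts on functions as the commutator. -/
theorem vectorDeriv_mlieBracket [CompleteSpace E] {L : G → ℝ}
    (hL : ContMDiff 𝓘(ℝ, E) 𝓘(ℝ, ℝ) ∞ L) (V W : ∀ g : G, TangentSpace 𝓘(ℝ, E) g)
    (hV : ContMDiff 𝓘(ℝ, E) 𝓘(ℝ, E).tangent ∞ (fun g => (⟨g, V g⟩ : TangentBundle 𝓘(ℝ, E) G)))
    (hW : ContMDiff 𝓘(ℝ, E) 𝓘(ℝ, E).tangent ∞ (fun g => (⟨g, W g⟩ : TangentBundle 𝓘(ℝ, E) G)))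
    (x : G) :
    vectorDeriv L x (VectorField.mlieBracket 𝓘(ℝ, E) V W x) =
      vectorDeriv (fun k => vectorDeriv L k (W k)) x (V x) -
        vectorDeriv (fun k => vectorDeriv L k (V k)) x (W x) := by
  have htwo : (2 : WithTop ℕ∞) ≤ ∞ := WithTop.coe_le_coe.2 (le_top : (2 : ℕ∞) ≤ ⊤)
  have : IsManifold 𝓘(ℝ, E) 2 G := IsManifold.of_le (n := ∞) htwo
  have : IsManifold 𝓘(ℝ, E) 1 G := IsManifold.of_le (n := ∞) (by exact_mod_cast le_top)
  let e := extChartAt 𝓘(ℝ, E) x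
  let V' : E → E := VectorField.mpullbackWithin 𝓘(ℝ, E) 𝓘(ℝ, E) e.symm V (range 𝓘(ℝ, E))
  let W' : E → E := VectorField.mpullbackWithin 𝓘(ℝ, E) 𝓘(ℝ, E) e.symm W (range 𝓘(ℝ, E))
  have hset : e.symm ⁻¹' univ ∩ range 𝓘(ℝ, E) = univ := by
    rw [preimage_univ, univ_inter, ModelWithCorners.range_eq_univ]
  have hx : x ∈ e.source := mem_extChartAt_source x
  have hex : e.symm (e x) = x := e.left_inv hx
  have diff : ∀ X : ∀ g : G, TangentSpace 𝓘(ℝ, E) g,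
      ContMDiff 𝓘(ℝ, E) 𝓘(ℝ, E).tangent ∞ (fun g => (⟨g, X g⟩ : TangentBundle 𝓘(ℝ, E) G)) →
      DifferentiableAt ℝ (VectorField.mpullbackWithin 𝓘(ℝ, E) 𝓘(ℝ, E) e.symm X
        (range 𝓘(ℝ, E)) : E → E) (e x) := by
    intro X hX
    have d : DifferentiableWithinAt ℝ (VectorField.mpullbackWithin 𝓘(ℝ, E) 𝓘(ℝ, E) e.symm X
        (range 𝓘(ℝ, E)) : E → E) (e.symm ⁻¹' univ ∩ range 𝓘(ℝ, E)) (e x) :=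
      (((hX x).mdifferentiableAt (by simp)).mdifferentiableWithinAt
        (s := univ)).differentiableWithinAt_mpullbackWithin_vectorField
    rw [hset] at d
    exact differentiableWithinAt_univ.1 d
  have chain : ∀ f : G → ℝ, ContMDiff 𝓘(ℝ, E) 𝓘(ℝ, ℝ) ∞ f → ∀ y ∈ e.target, ∀ u : E,
      fderiv ℝ (f ∘ e.symm) y u = vectorDeriv f (e.symm y)
        (mfderivWithin 𝓘(ℝ, E) 𝓘(ℝ, E) e.symm (range 𝓘(ℝ, E)) y u) := by
    intro f hf y hy u
    have d1 := (mdifferentiableWithinAt_extChartAt_symm (I := 𝓘(ℝ, E)) hy).hasMFDerivWithinAt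
    have d2 := ((hf (e.symm y)).mdifferentiableAt (by simp)).hasMFDerivAt
    have d := d2.comp_hasMFDerivWithinAt y d1
    rw [ModelWithCorners.range_eq_univ, hasMFDerivWithinAt_univ] at d
    rw [← mfderiv_eq_fderiv]
    simp only [ModelWithCorners.range_eq_univ]
    exact congrArg (fun (A : E →L[ℝ] ℝ) => A u) (d.mfderiv)
  have along : ∀ f : G → ℝ, ContMDiff 𝓘(ℝ, E) 𝓘(ℝ, ℝ) ∞ f →
      ∀ X : ∀ g : G, TangentSpace 𝓘(ℝ, E) g, ∀ y ∈ e.target,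
      fderiv ℝ (f ∘ e.symm) y (VectorField.mpullbackWithin 𝓘(ℝ, E) 𝓘(ℝ, E) e.symm X
        (range 𝓘(ℝ, E)) y : E) = vectorDeriv f (e.symm y) (X (e.symm y)) := by
    intro f hf X y hy
    refine (chain f hf y hy _).trans ?_
    rw [VectorField.mpullbackWithin_apply,
      (isInvertible_mfderivWithin_extChartAt_symm hy).self_apply_inverse]
  let h : E → ℝ := L ∘ e.symm
  have hh : ContDiffAt ℝ ∞ h (e x) := by
    have := (contMDiffAt_iff.1 (hL x)).2
    rwa [ModelWithCorners.range_eq_univ, contDiffWithinAt_univ] at this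
  have hdh : DifferentiableAt ℝ (fderiv ℝ h) (e x) :=
    (hh.fderiv_right (m := 1) (by rw [one_add_one_eq_two]; exact htwo)).differentiableAt (by simp)
  -- In the chart, `Z(X(L))` is `D²h(Z', X') + Dh(DX' Z')`. The symmetric second-order part drops
  -- out of the commutator, leaving `Dh` of the bracket.
  have second : ∀ (X Z : ∀ g : G, TangentSpace 𝓘(ℝ, E) g),
      ContMDiff 𝓘(ℝ, E) 𝓘(ℝ, E).tangent ∞ (fun g => (⟨g, X g⟩ : TangentBundle 𝓘(ℝ, E) G)) →
      ∀ X' Z' : E → E, X' = VectorField.mpullbackWithin 𝓘(ℝ, E) 𝓘(ℝ, E) e.symm X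
        (range 𝓘(ℝ, E)) → Z' = VectorField.mpullbackWithin 𝓘(ℝ, E) 𝓘(ℝ, E) e.symm Z
        (range 𝓘(ℝ, E)) →
      vectorDeriv (fun k => vectorDeriv L k (X k)) x (Z x) =
        fderiv ℝ (fderiv ℝ h) (e x) (Z' (e x)) (X' (e x)) +
          fderiv ℝ h (e x) (fderiv ℝ X' (e x) (Z' (e x))) := by
    intro X Z hX X' Z' hX' hZ'
    have dX : DifferentiableAt ℝ X' (e x) := by rw [hX']; exact diff X hX
    have d1 := HasFDerivAt.clm_apply (c := fderiv ℝ h) (u := X') hdh.hasFDerivAt dX.hasFDerivAt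
    have e1 : ((fun k => vectorDeriv L k (X k)) ∘ e.symm) =ᶠ[𝓝 (e x)]
        fun y => fderiv ℝ h y (X' y) := by
      filter_upwards [extChartAt_target_mem_nhds (I := 𝓘(ℝ, E)) x] with y hy
      rw [hX']
      exact (along L hL X y hy).symm
    have e2 := along _ (contMDiff_vectorDeriv hL hX) Z (e x) (e.map_source hx)
    rw [hex] at e2
    rw [← e2, e1.fderiv_eq, d1.fderiv, hZ', hX', add_comm]
    rfl
  have sym : IsSymmSndFDerivAt ℝ h (e x) := by
    apply ContDiffAt.isSymmSndFDerivAt (n := ∞) hh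
    simpa using htwo
  rw [second W V hW W' V' rfl rfl, second V W hV V' W' rfl rfl, sym.eq (V' (e x)) (W' (e x))]
  let b : E := VectorField.lieBracket (E := E) ℝ V' W' (e x)
  have hb : b = fderiv ℝ W' (e x) (V' (e x)) - fderiv ℝ V' (e x) (W' (e x)) := rfl
  have hbr : (VectorField.mlieBracket 𝓘(ℝ, E) V W x : E) =
      mfderivWithin 𝓘(ℝ, E) 𝓘(ℝ, E) e.symm (range 𝓘(ℝ, E)) (e x) b := by
    -- The bracket on the manifold is defined with the inverse of the differential of the chart,
    -- while the chain rule produces the differential of the inverse chart.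
    have inv : (mfderiv 𝓘(ℝ, E) 𝓘(ℝ, E) e x : E →L[ℝ] E).inverse =
        (mfderivWithin 𝓘(ℝ, E) 𝓘(ℝ, E) e.symm (range 𝓘(ℝ, E)) (e x) : E →L[ℝ] E) := by
      apply ContinuousLinearMap.inverse_eq
      · exact mfderiv_extChartAt_comp_mfderivWithin_extChartAt_symm' (I := 𝓘(ℝ, E)) hx
      · exact mfderivWithin_extChartAt_symm_comp_mfderiv_extChartAt' (I := 𝓘(ℝ, E)) hx
    have hbs : b = VectorField.lieBracketWithin (E := E) ℝ V' W'
        (e.symm ⁻¹' univ ∩ range 𝓘(ℝ, E)) (e x) := by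
      rw [hset, VectorField.lieBracketWithin_univ]
    rw [← inv, hbs]
    rfl
  have key := chain L hL (e x) (e.map_source hx) b
  have move : ∀ p : G, p = x → ∀ u : E, (mfderiv 𝓘(ℝ, E) 𝓘(ℝ, ℝ) L p : E →L[ℝ] ℝ) u =
      (mfderiv 𝓘(ℝ, E) 𝓘(ℝ, ℝ) L x : E →L[ℝ] ℝ) u := by
    rintro p rfl u
    rfl
  have key2 : fderiv ℝ h (e x) b = vectorDeriv L x (VectorField.mlieBracket 𝓘(ℝ, E) V W x) := by
    refine key.trans ((move _ hex _).trans ?_)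
    exact congrArg (mfderiv 𝓘(ℝ, E) 𝓘(ℝ, ℝ) L x : E →L[ℝ] ℝ) hbr.symm
  rw [← key2, hb, map_sub]
  abel

end Functions

/-! ### Translations in a Lie groupoid and their smooth local extensions. -/

namespace LieGroupoid

open Set Filter Manifold Bundle

variable {E F G M : Type*} [NormedAddCommGroup E] [NormedSpace ℝ E]
  [NormedAddCommGroup F] [NormedSpace ℝ F]
  [TopologicalSpace G] [ChartedSpace E G] [TopologicalSpace M] [ChartedSpace F M]
  (𝒢 : LieGroupoid E F G M)

theorem mul_inv_mul (g k : G) (hk : 𝒢.tgt k = 𝒢.tgt g) : 𝒢.mul (𝒢.mul g (𝒢.inv k)) k = g := by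
  rw [← 𝒢.mul_assoc _ _ _ (by rw [𝒢.src_inv, hk]) (𝒢.tgt_inv k), 𝒢.inv_mul, hk, 𝒢.mul_one]

theorem tgt_mul_inv (g k : G) (hk : 𝒢.tgt k = 𝒢.tgt g) :
    𝒢.tgt (𝒢.mul g (𝒢.inv k)) = 𝒢.src k := by
  rw [𝒢.tgt_mul _ _ (by rw [𝒢.src_inv, hk]), 𝒢.tgt_inv]

/-- `(k g⁻¹) ((g k⁻¹) m) = m`. -/
theorem mul_inv_mul_mul (g k m : G) (hk : 𝒢.tgt k = 𝒢.tgt g) (hm : 𝒢.src m = 𝒢.src k) :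
    𝒢.mul (𝒢.mul k (𝒢.inv g)) (𝒢.mul (𝒢.mul g (𝒢.inv k)) m) = m := by
  have h1 : 𝒢.tgt k = 𝒢.src (𝒢.inv g) := by rw [𝒢.src_inv, hk]
  have h2 : 𝒢.tgt g = 𝒢.src (𝒢.inv k) := by rw [𝒢.src_inv, hk]
  have h3 : 𝒢.tgt (𝒢.mul k (𝒢.inv g)) = 𝒢.src (𝒢.mul g (𝒢.inv k)) := by
    rw [𝒢.tgt_mul _ _ h1, 𝒢.src_mul _ _ h2, 𝒢.tgt_inv]
  rw [𝒢.mul_assoc _ _ _ h3 (by rw [𝒢.tgt_mul_inv _ _ hk, hm]), 𝒢.mul_assoc _ g _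
    (by rw [𝒢.tgt_mul _ _ h1, 𝒢.tgt_inv]) h2, 𝒢.mul_inv_mul _ _ hk.symm, 𝒢.mul_inv, ← hm,
    𝒢.one_mul]

theorem contMDiffWithinAt_mul_left (a k : G) (ha : 𝒢.tgt a = 𝒢.src k) :
    ContMDiffWithinAt 𝓘(ℝ, E) 𝓘(ℝ, E) ∞ (fun s => 𝒢.mul a s) (𝒢.src ⁻¹' {𝒢.src k}) k :=
  (𝒢.contMDiffOn_mul (a, k) ha).comp (f := fun s => (a, s)) k
    (contMDiffWithinAt_const.prodMk contMDiffWithinAt_id) (fun _ hs => ha.trans hs.symm)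

/-- The product of smooth families of composable elements is smooth. -/
theorem contMDiffAt_mul {E₀ H₀ N : Type*} [NormedAddCommGroup E₀] [NormedSpace ℝ E₀]
    [TopologicalSpace H₀] {I₀ : ModelWithCorners ℝ E₀ H₀}
    [TopologicalSpace N] [ChartedSpace H₀ N] {a b : N → G} {p : N}
    (ha : ContMDiffAt I₀ 𝓘(ℝ, E) ∞ a p) (hb : ContMDiffAt I₀ 𝓘(ℝ, E) ∞ b p)
    (hab : ∀ᶠ q in 𝓝 p, 𝒢.tgt (a q) = 𝒢.src (b q)) :
    ContMDiffAt I₀ 𝓘(ℝ, E) ∞ (fun q => 𝒢.mul (a q) (b q)) p := by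
  have h := (𝒢.contMDiffOn_mul (a p, b p) hab.self_of_nhds).comp (f := fun q => (a q, b q))
    (s := {q | 𝒢.tgt (a q) = 𝒢.src (b q)}) p
    (ha.prodMk hb).contMDiffWithinAt (fun _ hs => hs)
  -- The set of parameters with composable values is a neighbourhood, so no restriction to it
  -- remains.
  exact h.contMDiffAt hab

/-- Smooth families of translations near `g`: `R` projects onto the `β`-fibre of `g`, the map
`k ↦ P k m` extends `m ↦ (g k⁻¹) m` off the `α`-fibre of `k`, and `k ↦ T k m` extends
`m ↦ (k g⁻¹) m` off the `α`-fibre of `g`. -/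
theorem exists_local_translations (g : G) :
    ∃ (R : G → G) (P T : G → G → G),
      ContMDiffAt 𝓘(ℝ, E) 𝓘(ℝ, E) ∞ R g ∧ R g = g ∧
      ContMDiffAt (𝓘(ℝ, E).prod 𝓘(ℝ, E)) 𝓘(ℝ, E) ∞ (Function.uncurry P) (g, g) ∧
      ContMDiffAt (𝓘(ℝ, E).prod 𝓘(ℝ, E)) 𝓘(ℝ, E) ∞ (Function.uncurry T) (g, g) ∧
      (∀ᶠ k in 𝓝 g, 𝒢.tgt (R k) = 𝒢.tgt g ∧ (𝒢.tgt k = 𝒢.tgt g → R k = k)) ∧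
      (∀ᶠ p in 𝓝 (g, g), 𝒢.tgt p.1 = 𝒢.tgt g → 𝒢.src p.2 = 𝒢.src p.1 →
        P p.1 p.2 = 𝒢.mul (𝒢.mul g (𝒢.inv p.1)) p.2) ∧
      (∀ᶠ p in 𝓝 (g, g), 𝒢.tgt p.1 = 𝒢.tgt g → 𝒢.src p.2 = 𝒢.src g →
        T p.1 p.2 = 𝒢.mul (𝒢.mul p.1 (𝒢.inv g)) p.2) := by
  obtain ⟨Sβ, cβ, gβ, eβ⟩ := exists_fiber_projection 𝒢.isSubmersion_tgt g
  obtain ⟨Sα, cα, gα, eα⟩ := exists_fiber_projection 𝒢.isSubmersion_src g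
  -- The first argument prescribes the fibre; freezing it at `g` projects everything near `g` onto
  -- the `β`-fibre of `g`.
  let R : G → G := fun k => Sβ (g, k)
  have hRg : R g = g := gβ
  have cR : ContMDiffAt 𝓘(ℝ, E) 𝓘(ℝ, E) ∞ R g :=
    ContMDiffAt.comp g (g := Sβ) (f := fun k => (g, k)) cβ
      (contMDiffAt_const.prodMk contMDiffAt_id)
  have tR : Tendsto (fun k : G => (g, k)) (𝓝 g) (𝓝 (g, g)) :=
    (Continuous.prodMk_right g).tendsto g
  have eR : ∀ᶠ k in 𝓝 g, 𝒢.tgt (R k) = 𝒢.tgt g ∧ (𝒢.tgt k = 𝒢.tgt g → R k = k) :=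
    tR.eventually eβ
  have cR1 : ContMDiffAt (𝓘(ℝ, E).prod 𝓘(ℝ, E)) 𝓘(ℝ, E) ∞ (fun p : G × G => R p.1) (g, g) :=
    ContMDiffAt.comp (g, g) (g := R) (f := Prod.fst) cR contMDiffAt_fst
  have eR1 : ∀ᶠ p in 𝓝 (g, g), 𝒢.tgt (R p.1) = 𝒢.tgt g ∧ (𝒢.tgt p.1 = 𝒢.tgt g → R p.1 = p.1) :=
    (continuousAt_fst (p := (g, g))).eventually eR
  have cRi : ContMDiffAt (𝓘(ℝ, E).prod 𝓘(ℝ, E)) 𝓘(ℝ, E) ∞ (fun p : G × G => 𝒢.inv (R p.1))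
      (g, g) :=
    ContMDiffAt.comp (g, g) (g := 𝒢.inv) (f := fun p : G × G => R p.1) (𝒢.contMDiff_inv _) cR1
  have cS1 : ContMDiffAt (𝓘(ℝ, E).prod 𝓘(ℝ, E)) 𝓘(ℝ, E) ∞ (fun p : G × G => (Sα (R p.1, p.2)))
      (g, g) := by
    refine ContMDiffAt.comp (g, g) (g := Sα) (f := fun p : G × G => (R p.1, p.2)) ?_
      (cR1.prodMk contMDiffAt_snd)
    show ContMDiffAt _ _ _ Sα (R g, g)
    rwa [hRg]
  have cS2 : ContMDiffAt (𝓘(ℝ, E).prod 𝓘(ℝ, E)) 𝓘(ℝ, E) ∞ (fun p : G × G => (Sα (g, p.2)))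
      (g, g) :=
    ContMDiffAt.comp (g, g) (g := Sα) (f := fun p : G × G => (g, p.2)) cα
      (contMDiffAt_const.prodMk contMDiffAt_snd)
  have t1 : Tendsto (fun p : G × G => (R p.1, p.2)) (𝓝 (g, g)) (𝓝 (g, g)) := by
    have : ContinuousAt (fun p : G × G => (R p.1, p.2)) (g, g) :=
      cR1.continuousAt.prodMk continuousAt_snd
    have h3 := this.tendsto
    simp only [hRg] at h3
    exact h3
  have t2 : Tendsto (fun p : G × G => (g, p.2)) (𝓝 (g, g)) (𝓝 (g, g)) := by
    have : Continuous (fun p : G × G => (g, p.2)) := by fun_prop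
    exact this.tendsto (g, g)
  have e1 := t1.eventually eα
  have e2 := t2.eventually eα
  -- Projecting `k` to the `β`-fibre of `g`, and `m` to the required `α`-fibre, makes all products
  -- composable for every nearby `k` and `m`. Where the fibre conditions already hold, the
  -- projections do nothing and the true translations reappear.
  refine ⟨R, fun k m => 𝒢.mul (𝒢.mul g (𝒢.inv (R k))) (Sα (R k, m)),
    fun k m => 𝒢.mul (𝒢.mul (R k) (𝒢.inv g)) (Sα (g, m)), cR, hRg, ?_, ?_, eR, ?_, ?_⟩
  · refine 𝒢.contMDiffAt_mul (𝒢.contMDiffAt_mul contMDiffAt_const cRi ?_) cS1 ?_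
    · filter_upwards [eR1] with p hp
      rw [𝒢.src_inv, hp.1]
    · filter_upwards [eR1, e1] with p hp hp1
      rw [𝒢.tgt_mul_inv _ _ hp.1, hp1.1]
  · refine 𝒢.contMDiffAt_mul (𝒢.contMDiffAt_mul cR1 contMDiffAt_const ?_) cS2 ?_
    · filter_upwards [eR1] with p hp
      rw [𝒢.src_inv, hp.1]
    · filter_upwards [eR1, e2] with p hp hp1
      rw [𝒢.tgt_mul_inv _ _ hp.1.symm, hp1.1]
  · filter_upwards [eR1, e1] with p hp hp1 h3 h4
    have hR := hp.2 h3
    simp only [hR] at hp1 ⊢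
    rw [hp1.2 h4]
  · filter_upwards [eR1, e2] with p hp hp1 h3 h4
    rw [hp.2 h3, hp1.2 h4]

end LieGroupoid

/-! ### Smooth dependence of partial differentials on parameters. -/

section PartialDerivatives

open Set Filter Manifold Bundle

variable {E : Type*} [NormedAddCommGroup E] [NormedSpace ℝ E]
  {G : Type*} [TopologicalSpace G] [ChartedSpace E G] [IsManifold 𝓘(ℝ, E) ∞ G]

theorem ContMDiffAt.eventually_mdifferentiableAt_slice {E' G' : Type*} [NormedAddCommGroup E']
    [NormedSpace ℝ E'] [TopologicalSpace G'] [ChartedSpace E' G'] [IsManifold 𝓘(ℝ, E') ∞ G']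
    {f : G → G → G'} {p : G × G}
    (hf : ContMDiffAt (𝓘(ℝ, E).prod 𝓘(ℝ, E)) 𝓘(ℝ, E') ∞ (Function.uncurry f) p) :
    ∀ᶠ q in 𝓝 p, MDifferentiableAt 𝓘(ℝ, E) 𝓘(ℝ, E') (f q.1) q.2 := by
  have h1 : (1 : WithTop ℕ∞) ≤ ∞ := by exact_mod_cast le_top
  have : IsManifold 𝓘(ℝ, E) 1 G := IsManifold.of_le (n := ∞) h1
  have : IsManifold 𝓘(ℝ, E') 1 G' := IsManifold.of_le (n := ∞) h1
  -- The order is lowered to one because smoothness of finite order at a point spreads to a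
  -- neighbourhood.
  filter_upwards [(contMDiffAt_iff_contMDiffAt_nhds (by simp)).1 (hf.of_le h1)] with q hq
  have := ContMDiffAt.comp q.2 (g := Function.uncurry f) (f := fun m => (q.1, m)) hq
    (contMDiffAt_const.prodMk contMDiffAt_id)
  exact this.mdifferentiableAt (by simp)

/-- The partial differential at a fixed point of a smooth real function of two variables depends
differentiably on the first variable. -/
theorem ContMDiffAt.mdifferentiableAt_partial {f : G → G → ℝ} {g : G}
    (hf : ContMDiffAt (𝓘(ℝ, E).prod 𝓘(ℝ, E)) 𝓘(ℝ, ℝ) ∞ (Function.uncurry f) (g, g)) :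
    MDifferentiableAt (M' := E →L[ℝ] ℝ) 𝓘(ℝ, E) 𝓘(ℝ, E →L[ℝ] ℝ)
      (fun k => (mfderiv 𝓘(ℝ, E) 𝓘(ℝ, ℝ) (f k) g : E →L[ℝ] ℝ)) g := by
  have : IsManifold 𝓘(ℝ, E) 1 G := IsManifold.of_le (n := ∞) (by exact_mod_cast le_top)
  have h := (ContMDiffAt.mfderiv (m := 1) f (fun _ => g) hf contMDiffAt_const
    (by rw [one_add_one_eq_two]; exact WithTop.coe_le_coe.2 (le_top : (2 : ℕ∞) ≤ ⊤))).mdifferentiableAt (by simp)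
  refine h.congr_of_eventuallyEq (Eventually.of_forall fun k => ?_)
  -- The general smoothness statement is in tangent coordinates. Here the source point stays at `g`
  -- and the target is `ℝ`, so both coordinate changes are the identity.
  have e : ∀ D : E →L[ℝ] ℝ,
      ((tangentBundleCore 𝓘(ℝ, ℝ) ℝ).coordChange (achart ℝ (f k g)) (achart ℝ (f g g)) (f k g) ∘L
        D ∘L (tangentBundleCore 𝓘(ℝ, E) G).coordChange (achart E g) (achart E g) g) = D := by
    intro D
    refine ContinuousLinearMap.ext fun v => ?_
    have e1 : (tangentBundleCore 𝓘(ℝ, E) G).coordChange (achart E g) (achart E g) g v = v :=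
      (tangentBundleCore 𝓘(ℝ, E) G).coordChange_self (achart E g) g (mem_chart_source E g) v
    rw [TangentBundle.coordChange_model_space]
    exact congrArg D e1
  exact ((inTangentCoordinates_eq (I := 𝓘(ℝ, E)) (I' := 𝓘(ℝ, ℝ)) (x₀ := g) (x := k) (fun _ => g)
    (fun x => f x g) (fun x => (mfderiv 𝓘(ℝ, E) 𝓘(ℝ, ℝ) (f x) g : E →L[ℝ] ℝ))
    (mem_chart_source E g) (mem_univ _)).trans (e _)).symm

/-- The partial differential of a smooth family of maps, evaluated on a smooth vector field, is
differentiable as a function with values in a fixed tangent space. -/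
theorem ContMDiffAt.mdifferentiableAt_partial_apply {P : G → G → G} {R : G → G} {g : G}
    (hP : ContMDiffAt (𝓘(ℝ, E).prod 𝓘(ℝ, E)) 𝓘(ℝ, E) ∞ (Function.uncurry P) (g, g))
    (hR : ContMDiffAt 𝓘(ℝ, E) 𝓘(ℝ, E) ∞ R g) (hRg : R g = g)
    (hPR : ∀ᶠ k in 𝓝 g, P (R k) (R k) = g) {V : ∀ g : G, TangentSpace 𝓘(ℝ, E) g}
    (hV : ContMDiff 𝓘(ℝ, E) 𝓘(ℝ, E).tangent ∞ (fun g => (⟨g, V g⟩ : TangentBundle 𝓘(ℝ, E) G))) :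
    MDifferentiableAt (M' := E) 𝓘(ℝ, E) 𝓘(ℝ, E)
      (fun k => (mfderiv 𝓘(ℝ, E) 𝓘(ℝ, E) (P (R k)) (R k) (V (R k)) : E)) g := by
  have h1 : (1 : WithTop ℕ∞) ≤ ∞ := by exact_mod_cast le_top
  have : IsManifold 𝓘(ℝ, E) 1 G := IsManifold.of_le (n := ∞) h1
  have hf : ContMDiffAt (𝓘(ℝ, E).prod 𝓘(ℝ, E)) 𝓘(ℝ, E) ∞
      (Function.uncurry fun x m => P (R x) m) (g, R g) := by
    refine ContMDiffAt.comp (g, R g) (g := Function.uncurry P) (f := fun p : G × G => (R p.1, p.2))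
      ?_ (ContMDiffAt.prodMk (ContMDiffAt.comp (g, R g) (g := R) (f := Prod.fst) hR
        contMDiffAt_fst) contMDiffAt_snd)
    show ContMDiffAt _ _ _ (Function.uncurry P) (R g, R g)
    rwa [hRg]
  have hφ := ContMDiffAt.mfderiv (m := 1) (fun x m => P (R x) m) R hf (hR.of_le h1)
    (by rw [one_add_one_eq_two]; exact WithTop.coe_le_coe.2 (le_top : (2 : ℕ∞) ≤ ⊤))
  have hv : ContMDiffAt 𝓘(ℝ, E) 𝓘(ℝ, E).tangent 1
      (fun k => (⟨R k, V (R k)⟩ : TangentBundle 𝓘(ℝ, E) G)) g :=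
    ContMDiffAt.comp g (g := fun g => (⟨g, V g⟩ : TangentBundle 𝓘(ℝ, E) G))
      ((hV (R g)).of_le h1) (hR.of_le h1)
  -- The base point of the values is constantly `g` near `g`, so bundle smoothness can be read as
  -- smoothness into one fixed space.
  have hb : ContMDiffAt 𝓘(ℝ, E) 𝓘(ℝ, E) 1 (fun k => P (R k) (R k)) g :=
    contMDiffAt_const.congr_of_eventuallyEq hPR
  have key := ContMDiffAt.clm_apply_of_inCoordinates
    (ϕ := fun k => mfderiv 𝓘(ℝ, E) 𝓘(ℝ, E) (P (R k)) (R k)) hφ hv hb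
  have key2 := (contMDiffAt_totalSpace.1 key).2
  refine (key2.congr_of_eventuallyEq ?_).mdifferentiableAt (by simp)
  filter_upwards [hPR] with k hk
  exact (TangentBundle.trivializationAt_apply_snd_of_eq (hk.trans hPR.self_of_nhds.symm) _).symm

end PartialDerivatives

/-! ### Left transport and the mixed second derivative. -/

namespace LieGroupoid

open Set Filter Manifold Bundle

variable {E F G M : Type*} [NormedAddCommGroup E] [NormedSpace ℝ E]
  [NormedAddCommGroup F] [NormedSpace ℝ F]
  [TopologicalSpace G] [ChartedSpace E G] [TopologicalSpace M] [ChartedSpace F M]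
  (𝒢 : LieGroupoid E F G M)

/-- The derivative naturally lands over `(g k⁻¹) k`, which equals `g` only propositionally; naming
it as a map `E → E` keeps this out of later arguments. -/
theorem hasMFDerivWithinAt_leftTransport (g k : G) (hk : 𝒢.tgt k = 𝒢.tgt g) :
    ∃ D : E →L[ℝ] E, HasMFDerivWithinAt 𝓘(ℝ, E) 𝓘(ℝ, E)
      (fun s => 𝒢.mul (𝒢.mul g (𝒢.inv k)) s) (𝒢.src ⁻¹' {𝒢.src k}) k D ∧
      ∀ v : TangentSpace 𝓘(ℝ, E) k, 𝒢.leftTransport g k v = D (v : E) :=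
  ⟨_, ((𝒢.contMDiffWithinAt_mul_left _ k (𝒢.tgt_mul_inv g k hk)).mdifferentiableWithinAt
    (by simp)).hasMFDerivWithinAt, fun _ => rfl⟩

variable [IsManifold 𝓘(ℝ, E) ∞ G] [IsManifold 𝓘(ℝ, F) ∞ M]

/-- Translation by `g g⁻¹` is the identity on the `α`-fibre. Verticality is needed because the
derivative within the fibre is determined only on vertical vectors. -/
theorem leftTransport_self (g : G) (v : TangentSpace 𝓘(ℝ, E) g) (hv : v ∈ 𝒢.vertSrc g) :
    𝒢.leftTransport g g v = v := by
  obtain ⟨D, hD, e⟩ := 𝒢.hasMFDerivWithinAt_leftTransport g g rfl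
  rw [e]
  have hid : HasMFDerivWithinAt 𝓘(ℝ, E) 𝓘(ℝ, E) (fun s => 𝒢.mul (𝒢.mul g (𝒢.inv g)) s)
      (𝒢.src ⁻¹' {𝒢.src g}) g (ContinuousLinearMap.id ℝ E) := by
    have hs : ∀ s, 𝒢.src s = 𝒢.src g → 𝒢.mul (𝒢.mul g (𝒢.inv g)) s = s := by
      intro s hs
      rw [𝒢.mul_inv, ← hs, 𝒢.one_mul]
    exact ((hasMFDerivAt_id (I := 𝓘(ℝ, E)) g).hasMFDerivWithinAt).congr_of_eventuallyEq
      (by filter_upwards [self_mem_nhdsWithin] with s h using hs s h) (hs g rfl)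
  exact hD.eq_on_vertical 𝒢.isSubmersion_src hid v hv

/-- For a smooth section `Y` of `Vα`, the map that defines `derivAlongTgt` is differentiable. -/
theorem mdifferentiableWithinAt_leftTransport (g : G) (Y : ∀ k : G, TangentSpace 𝓘(ℝ, E) k)
    (hY : ∀ k, Y k ∈ 𝒢.vertSrc k)
    (hYs : ContMDiff 𝓘(ℝ, E) 𝓘(ℝ, E).tangent ∞
      (fun g => (⟨g, Y g⟩ : TangentBundle 𝓘(ℝ, E) G))) :
    MDifferentiableWithinAt (M' := E) 𝓘(ℝ, E) 𝓘(ℝ, E) (fun k => (𝒢.leftTransport g k (Y k) : E))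
      (𝒢.tgt ⁻¹' {𝒢.tgt g}) g := by
  obtain ⟨R, P, -, cR, hRg, cP, -, eR, eP, -⟩ := 𝒢.exists_local_translations g
  have tR : Tendsto (fun k => (R k, R k)) (𝓝 g) (𝓝 (g, g)) := by
    have := (cR.continuousAt.prodMk cR.continuousAt).tendsto
    simpa only [hRg] using this
  have hPR : ∀ᶠ k in 𝓝 g, P (R k) (R k) = g := by
    filter_upwards [eR, tR.eventually eP] with k h1 h2
    rw [h2 h1.1 rfl, 𝒢.mul_inv_mul _ _ h1.1]
  have td : Tendsto (fun k : G => (k, k)) (𝓝 g) (𝓝 (g, g)) :=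
    (continuous_id.prodMk continuous_id).tendsto g
  have hev : ∀ᶠ k in 𝓝 g, 𝒢.tgt k = 𝒢.tgt g →
      (𝒢.leftTransport g k (Y k) : E) =
        (mfderiv 𝓘(ℝ, E) 𝓘(ℝ, E) (P (R k)) (R k) (Y (R k)) : E) := by
    -- Comparing derivatives at `k` requires `P` to agree with the translation near `(k, k)`, not
    -- merely at that point.
    filter_upwards [eR, td.eventually eP.eventually_nhds,
      td.eventually cP.eventually_mdifferentiableAt_slice] with k h1 h2 h3 hk
    rw [h1.2 hk]
    obtain ⟨D, hD, e⟩ := 𝒢.hasMFDerivWithinAt_leftTransport g k hk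
    rw [e]
    have hD2 := (h3.hasMFDerivAt.hasMFDerivWithinAt
      (s := 𝒢.src ⁻¹' {𝒢.src k})).congr_of_eventuallyEq
      (f₁ := fun s => 𝒢.mul (𝒢.mul g (𝒢.inv k)) s) (by
        have h4 : ∀ᶠ s in 𝓝 k, 𝒢.src s = 𝒢.src k → P k s = 𝒢.mul (𝒢.mul g (𝒢.inv k)) s := by
          filter_upwards [(Continuous.prodMk_right k).tendsto k |>.eventually h2] with s hs
          exact hs hk
        filter_upwards [self_mem_nhdsWithin, nhdsWithin_le_nhds h4] with s h5 h6
        exact (h6 h5).symm) (h2.self_of_nhds hk rfl).symm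
    exact hD.eq_on_vertical 𝒢.isSubmersion_src hD2 (Y k) (hY k)
  refine ((cP.mdifferentiableAt_partial_apply cR hRg hPR
    hYs).mdifferentiableWithinAt).congr_of_eventuallyEq ?_ (hev.self_of_nhds rfl)
  filter_upwards [self_mem_nhdsWithin, nhdsWithin_le_nhds hev] with k h1 h2
  exact h2 h1

/-- For a smooth section `Y` of `Vα`, a curve `γ` in the `β`-fibre of `g` with velocity `x` and a
curve `η` in the `α`-fibre of `g` with velocity `Y g`, the number `x(Y(L)) - (∇_x Y)(L)` is the
mixed second derivative of `(t, s) ↦ L(γ(t) g⁻¹ η(s))`. -/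
theorem hasDerivAt_deriv_mul {L : G → ℝ} (hL : ContMDiff 𝓘(ℝ, E) 𝓘(ℝ, ℝ) ∞ L) (g : G)
    (Y : ∀ k : G, TangentSpace 𝓘(ℝ, E) k) (hY : ∀ k, Y k ∈ 𝒢.vertSrc k)
    (hYs : ContMDiff 𝓘(ℝ, E) 𝓘(ℝ, E).tangent ∞
      (fun g => (⟨g, Y g⟩ : TangentBundle 𝓘(ℝ, E) G)))
    (x : TangentSpace 𝓘(ℝ, E) g) (hx : x ∈ 𝒢.vertTgt g) {γ η : ℝ → G} (hγ0 : γ 0 = g)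
    (hγ : HasMFDerivAt 𝓘(ℝ, ℝ) 𝓘(ℝ, E) γ 0
      (ContinuousLinearMap.toSpanSingleton ℝ (x : E) : ℝ →L[ℝ] E))
    (hγs : ∀ᶠ t in 𝓝 (0 : ℝ), 𝒢.tgt (γ t) = 𝒢.tgt g) (hη0 : η 0 = g)
    (hη : HasMFDerivAt 𝓘(ℝ, ℝ) 𝓘(ℝ, E) η 0
      (ContinuousLinearMap.toSpanSingleton ℝ (Y g : E) : ℝ →L[ℝ] E))
    (hηs : ∀ᶠ s in 𝓝 (0 : ℝ), 𝒢.src (η s) = 𝒢.src g) :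
    HasDerivAt (fun t => deriv (fun s => L (𝒢.mul (𝒢.mul (γ t) (𝒢.inv g)) (η s))) 0)
      (vectorDeriv (fun k => vectorDeriv L k (Y k)) g x
        - vectorDeriv L g (𝒢.derivAlongTgt g x Y)) 0 := by
  obtain ⟨-, -, T, -, -, -, cT, -, -, eT⟩ := 𝒢.exists_local_translations g
  have cLT : ContMDiffAt (𝓘(ℝ, E).prod 𝓘(ℝ, E)) 𝓘(ℝ, ℝ) ∞
      (Function.uncurry fun k m => L (T k m)) (g, g) := (hL _).comp (g, g) cT
  -- On the `β`-fibre of `g`, `A k` is the differential at `g` of `m ↦ L(k g⁻¹ m)` along the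
  -- `α`-fibre; using the extension `T` makes it differentiable in `k`.
  let A : G → E →L[ℝ] ℝ := fun k => mfderiv 𝓘(ℝ, E) 𝓘(ℝ, ℝ) (fun m => L (T k m)) g
  have hA := cLT.mdifferentiableAt_partial
  have fact1 : ∀ᶠ k in 𝓝 g, 𝒢.tgt k = 𝒢.tgt g → ∀ (c : ℝ → G) (w : E), c 0 = g →
      HasMFDerivAt 𝓘(ℝ, ℝ) 𝓘(ℝ, E) c 0 (ContinuousLinearMap.toSpanSingleton ℝ w : ℝ →L[ℝ] E) →
      (∀ᶠ s in 𝓝 (0 : ℝ), 𝒢.src (c s) = 𝒢.src g) →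
      HasDerivAt (fun s => L (𝒢.mul (𝒢.mul k (𝒢.inv g)) (c s))) (A k w) 0 := by
    -- Currying fixes the neighbourhood of `k` before any curve is chosen, so it serves all curves
    -- at once.
    filter_upwards [eT.curry_nhds, cLT.eventually_mdifferentiableAt_slice.curry_nhds]
      with k h1 h2 hk c w hc0 hc hcs
    have d := (h2.self_of_nhds.hasMFDerivAt.comp_curve hc0 hc).hasDerivAt_curve
    refine d.congr_of_eventuallyEq ?_
    have hc' : Tendsto c (𝓝 0) (𝓝 g) := by
      have := hc.continuousAt.tendsto
      rwa [hc0] at this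
    filter_upwards [hcs, hc'.eventually h1] with s h3 h4
    exact congrArg L (h4 hk h3).symm
  have fact2 : ∀ᶠ k in 𝓝 g, 𝒢.tgt k = 𝒢.tgt g → ∀ v ∈ 𝒢.vertSrc k,
      vectorDeriv L k v = A k (𝒢.leftTransport g k v) := by
    filter_upwards [fact1] with k h1 hk v hv
    obtain ⟨c, hc0, hc, hcs⟩ := exists_curve_in_fiber 𝒢.isSubmersion_src k v hv
    obtain ⟨D, hD, e⟩ := 𝒢.hasMFDerivWithinAt_leftTransport g k hk
    rw [e]
    have hcg : 𝒢.tgt g = 𝒢.src (𝒢.inv k) := by rw [𝒢.src_inv, hk]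
    -- The test curve is `s ↦ (g k⁻¹) c(s)`. It passes through `g` with the transported velocity,
    -- and translating it by `k g⁻¹` gives back `c`.
    have d1 := h1 hk _ _ (by simp only [Function.comp_apply, hc0, 𝒢.mul_inv_mul _ _ hk])
      (hD.comp_curve hc0 hc hcs) (by
        filter_upwards [hcs] with s hs
        rw [Function.comp_apply, 𝒢.src_mul _ _ (by rw [𝒢.tgt_mul_inv _ _ hk, hs]),
          𝒢.src_mul _ _ hcg])
    have d2 := (((hL k).mdifferentiableAt (by simp)).hasMFDerivAt.comp_curve hc0
      hc).hasDerivAt_curve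
    refine d2.unique (d1.congr_of_eventuallyEq ?_)
    filter_upwards [hcs] with s hs
    exact congrArg L (𝒢.mul_inv_mul_mul g k (c s) hk hs).symm
  have hγt : Tendsto γ (𝓝 0) (𝓝 g) := by
    have := hγ.continuousAt.tendsto
    rwa [hγ0] at this
  obtain ⟨A', hA'⟩ : ∃ A' : E →L[ℝ] ℝ, HasDerivAt (fun t => A (γ t)) A' 0 :=
    ⟨_, (hA.hasMFDerivAt.comp_curve hγ0 hγ).hasDerivAt_curve⟩
  have hy : HasDerivAt (fun t => (𝒢.leftTransport g (γ t) (Y (γ t)) : E))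
      (𝒢.derivAlongTgt g x Y : E) 0 :=
    ((𝒢.mdifferentiableWithinAt_leftTransport g Y hY hYs).hasMFDerivWithinAt.comp_curve hγ0 hγ
      hγs).hasDerivAt_curve
  have hprod := hA'.clm_apply hy
  have hYL : HasDerivAt (fun t => vectorDeriv L (γ t) (Y (γ t)))
      (vectorDeriv (fun k => vectorDeriv L k (Y k)) g x) 0 :=
    (((contMDiff_vectorDeriv hL hYs g).mdifferentiableAt (by simp)).hasMFDerivAt.comp_curve hγ0
      hγ).hasDerivAt_curve
  -- Product rule for `Y(L) = A(γ(t))` applied to the transported `Y`: the term with `A(g)` will be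
  -- `(∇_x Y)(L)`, and what remains is `A'(Y(g))`.
  have h0 := hYL.unique (hprod.congr_of_eventuallyEq (by
    filter_upwards [hγs, hγt.eventually fact2] with t h1 h2
    exact h2 h1 _ (hY _)))
  have hLd : vectorDeriv L g (𝒢.derivAlongTgt g x Y) = A g (𝒢.derivAlongTgt g x Y : E) := by
    have hm := 𝒢.derivAlongTgt_mem g x hx Y hY
    rw [fact2.self_of_nhds rfl _ hm, 𝒢.leftTransport_self g _ hm]
  have move : ∀ p : G, p = g → (𝒢.leftTransport g p (Y p) : E) = (Y g : E) := by
    rintro p rfl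
    exact 𝒢.leftTransport_self p _ (hY p)
  rw [move _ hγ0, hγ0] at h0
  rw [h0, hLd, add_sub_cancel_right]
  -- With the vector held fixed only `A` is differentiated, and on `Y(g)` this is the outer
  -- derivative of the mixed one.
  have hfin : ∀ y : E, HasDerivAt (fun t => A (γ t) y) (A' y) 0 := fun y => by
    simpa using hA'.clm_apply (hasDerivAt_const (0 : ℝ) y)
  refine (hfin (Y g)).congr_of_eventuallyEq ?_
  filter_upwards [hγs, hγt.eventually fact1] with t h1 h2
  exact (h2 h1 η _ hη0 hη hηs).deriv

end LieGroupoid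

/-! ### The Euler-Lagrange operator along curves, and the differential of `Θ⁺`. -/

namespace LieGroupoid

open Set Filter Manifold Bundle

section EulerLagrange

variable {E F G M : Type*} [NormedAddCommGroup E] [NormedSpace ℝ E]
  [NormedAddCommGroup F] [NormedSpace ℝ F]
  [TopologicalSpace G] [ChartedSpace E G] [TopologicalSpace M] [ChartedSpace F M]
  (𝒢 : LieGroupoid E F G M)

/-- `a = a (b b⁻¹) = (a b) b⁻¹ = b⁻¹`. -/
theorem eq_inv_of_mul_eq_one (a b : G) (hab : 𝒢.tgt a = 𝒢.src b)
    (h : 𝒢.mul a b = 𝒢.one (𝒢.tgt b)) : a = 𝒢.inv b := by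
  have h1 := 𝒢.mul_assoc a b (𝒢.inv b) hab (𝒢.src_inv b).symm
  rw [𝒢.mul_inv, ← hab, 𝒢.mul_one, h, ← 𝒢.src_inv, 𝒢.one_mul] at h1
  exact h1

/-- The discrete Euler-Lagrange operator computed along a curve in the `α`-fibre. -/
theorem hasDerivAt_eulerLagrange {L : G → ℝ} (hL : ContMDiff 𝓘(ℝ, E) 𝓘(ℝ, ℝ) ∞ L) (g h : G) (x : M)
    (hg : 𝒢.tgt g = x) (hh : 𝒢.src h = x) (v : 𝒢.algebroidFiber x) {c : ℝ → G}
    (hc0 : c 0 = 𝒢.one x)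
    (hc : HasMFDerivAt 𝓘(ℝ, ℝ) 𝓘(ℝ, E) c 0
      (ContinuousLinearMap.toSpanSingleton ℝ (v.1 : E) : ℝ →L[ℝ] E))
    (hcs : ∀ᶠ s in 𝓝 (0 : ℝ), 𝒢.src (c s) = x) :
    HasDerivAt (fun s => L (𝒢.mul g (c s)) + L (𝒢.mul (𝒢.inv (c s)) h))
      (𝒢.eulerLagrange L g h x hg hh v) 0 := by
  have m1 : ContMDiffWithinAt 𝓘(ℝ, E) 𝓘(ℝ, E) ∞ (fun k => 𝒢.mul g k) (𝒢.src ⁻¹' {x})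
      (𝒢.one x) := by
    have := 𝒢.contMDiffWithinAt_mul_left g (𝒢.one x) (by rw [hg, 𝒢.src_one])
    rwa [𝒢.src_one] at this
  have m2 : ContMDiffWithinAt 𝓘(ℝ, E) 𝓘(ℝ, E) ∞ (fun k => 𝒢.mul (𝒢.inv k) h) (𝒢.src ⁻¹' {x})
      (𝒢.one x) :=
    (𝒢.contMDiffOn_mul (𝒢.inv (𝒢.one x), h) (by
      show 𝒢.tgt (𝒢.inv (𝒢.one x)) = 𝒢.src h
      rw [𝒢.tgt_inv, 𝒢.src_one, hh])).comp
      (f := fun k => (𝒢.inv k, h)) (𝒢.one x)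
      ((𝒢.contMDiff_inv _).contMDiffWithinAt.prodMk contMDiffWithinAt_const)
      (fun k (hk : 𝒢.src k = x) => ((𝒢.tgt_inv k).trans hk).trans hh.symm)
  have m : ContMDiffWithinAt 𝓘(ℝ, E) 𝓘(ℝ, ℝ) ∞
      (fun k => L (𝒢.mul g k) + L (𝒢.mul (𝒢.inv k) h)) (𝒢.src ⁻¹' {x}) (𝒢.one x) :=
    ((hL _).comp_contMDiffWithinAt _ m1).add ((hL _).comp_contMDiffWithinAt _ m2)
  exact ((m.mdifferentiableWithinAt (by simp)).hasMFDerivWithinAt.comp_curve hc0 hc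
    hcs).hasDerivAt_curve

end EulerLagrange

section Differential

variable {E F G M : Type*} [NormedAddCommGroup E] [NormedSpace ℝ E] [FiniteDimensional ℝ E]
  [NormedAddCommGroup F] [NormedSpace ℝ F]
  [TopologicalSpace G] [ChartedSpace E G] [IsManifold 𝓘(ℝ, E) ∞ G]
  [TopologicalSpace M] [ChartedSpace F M] [IsManifold 𝓘(ℝ, F) ∞ M]
  (𝒢 : LieGroupoid E F G M)

/-- With anchor `X + Y`, the `Y`-parts contribute a commutator of derivations that cancels the `[Y,
Y']` term of the bracket. Only derivatives in `β`-vertical directions and the `∇`-terms survive, and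
each parenthesis is a mixed second derivative. -/
theorem differentialOn_thetaPlus {L : G → ℝ} (hL : ContMDiff 𝓘(ℝ, E) 𝓘(ℝ, ℝ) ∞ L)
    (Z W : 𝒢.ProlongationSection) (g : G) :
    𝒢.differentialOn (𝒢.thetaPlus L) Z W g =
      (vectorDeriv (fun k => vectorDeriv L k (W.toFun k).2.1) g (Z.toFun g).1.1
        - vectorDeriv L g (𝒢.derivAlongTgt g (Z.toFun g).1.1 (fun k => (W.toFun k).2.1)))
      - (vectorDeriv (fun k => vectorDeriv L k (Z.toFun k).2.1) g (W.toFun g).1.1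
        - vectorDeriv L g (𝒢.derivAlongTgt g (W.toFun g).1.1 (fun k => (Z.toFun k).2.1))) := by
  have := FiniteDimensional.complete ℝ E
  have hb := vectorDeriv_mlieBracket hL _ _ Z.contMDiff_snd W.contMDiff_snd g
  have e : 𝒢.thetaPlus L g (𝒢.bracket Z W g) =
      vectorDeriv L g (VectorField.mlieBracket 𝓘(ℝ, E) (fun k => (Z.toFun k).2.1)
          (fun k => (W.toFun k).2.1) g
        + 𝒢.derivAlongTgt g (Z.toFun g).1.1 (fun k => (W.toFun k).2.1)
        - 𝒢.derivAlongTgt g (W.toFun g).1.1 (fun k => (Z.toFun k).2.1)) := rfl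
  have e2 : ∀ Y : 𝒢.ProlongationSection, (fun k => 𝒢.thetaPlus L k (Y.toFun k)) =
      fun k => vectorDeriv L k (Y.toFun k).2.1 := fun _ => rfl
  rw [differentialOn, e, e2, e2, map_sub, map_add, hb, anchor, anchor, map_add, map_add]
  ring

end Differential

end LieGroupoid

/-! ### Naturality under morphisms. -/

namespace LieGroupoidMorphism

open Set Filter Manifold Bundle

variable {E F G M E' F' G' M' : Type*}
  [NormedAddCommGroup E] [NormedSpace ℝ E] [NormedAddCommGroup F] [NormedSpace ℝ F]
  [TopologicalSpace G] [ChartedSpace E G] [TopologicalSpace M] [ChartedSpace F M]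
  [NormedAddCommGroup E'] [NormedSpace ℝ E'] [NormedAddCommGroup F'] [NormedSpace ℝ F']
  [TopologicalSpace G'] [ChartedSpace E' G'] [TopologicalSpace M'] [ChartedSpace F' M']
  {𝒢 : LieGroupoid E F G M} {𝒢' : LieGroupoid E' F' G' M'} (Φ : LieGroupoidMorphism 𝒢 𝒢')

theorem toFun_inv (g : G) : Φ.toFun (𝒢.inv g) = 𝒢'.inv (Φ.toFun g) := by
  refine 𝒢'.eq_inv_of_mul_eq_one _ _ (Φ.composable _ _ (𝒢.tgt_inv g)) ?_
  rw [← Φ.map_mul _ _ (𝒢.tgt_inv g), 𝒢.inv_mul, Φ.toFun_one, Φ.tgt_toFun]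

theorem hasMFDerivAt_toFun (g : G) : HasMFDerivAt 𝓘(ℝ, E) 𝓘(ℝ, E') Φ.toFun g
    (mfderiv 𝓘(ℝ, E) 𝓘(ℝ, E') Φ.toFun g) :=
  ((Φ.contMDiff_toFun g).mdifferentiableAt (by simp)).hasMFDerivAt

theorem vectorDeriv_comp {L' : G' → ℝ} (hL' : ContMDiff 𝓘(ℝ, E') 𝓘(ℝ, ℝ) ∞ L') (g : G)
    (v : TangentSpace 𝓘(ℝ, E) g) :
    vectorDeriv L' (Φ.toFun g) (mfderiv 𝓘(ℝ, E) 𝓘(ℝ, E') Φ.toFun g v) =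
      vectorDeriv (L' ∘ Φ.toFun) g v := by
  have h := ((hL' (Φ.toFun g)).mdifferentiableAt (by simp)).hasMFDerivAt.comp g
    (Φ.hasMFDerivAt_toFun g)
  exact (congrArg (fun A : E →L[ℝ] ℝ => A (v : E)) h.mfderiv).symm

theorem pullbackOne_thetaPlus {L' : G' → ℝ} (hL' : ContMDiff 𝓘(ℝ, E') 𝓘(ℝ, ℝ) ∞ L') :
    Φ.pullbackOne (𝒢'.thetaPlus L') = 𝒢.thetaPlus (L' ∘ Φ.toFun) := by
  funext g
  refine LinearMap.ext fun z => ?_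
  exact Φ.vectorDeriv_comp hL' g z.2.1

theorem pullbackOne_thetaMinus {L' : G' → ℝ} (hL' : ContMDiff 𝓘(ℝ, E') 𝓘(ℝ, ℝ) ∞ L') :
    Φ.pullbackOne (𝒢'.thetaMinus L') = 𝒢.thetaMinus (L' ∘ Φ.toFun) := by
  funext g
  refine LinearMap.ext fun z => ?_
  exact congrArg Neg.neg (Φ.vectorDeriv_comp hL' g z.1.1)

variable [IsManifold 𝓘(ℝ, E) ∞ G] [IsManifold 𝓘(ℝ, F) ∞ M]

/-- A curve `c` in the `α`-fibre and its image under `Φ` give one and the same real function of `s`,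
because `Φ` respects products and inverses. -/
theorem eulerLagrange_comp {L' : G' → ℝ} (hL' : ContMDiff 𝓘(ℝ, E') 𝓘(ℝ, ℝ) ∞ L') (g h : G) (x : M)
    (hg : 𝒢.tgt g = x) (hh : 𝒢.src h = x) (v : 𝒢.algebroidFiber x) :
    𝒢.eulerLagrange (L' ∘ Φ.toFun) g h x hg hh v =
      𝒢'.eulerLagrange L' (Φ.toFun g) (Φ.toFun h) (Φ.base x)
        ((Φ.tgt_toFun g).trans (congrArg Φ.base hg))
        ((Φ.src_toFun h).trans (congrArg Φ.base hh)) (Φ.algebroidMap x v) := by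
  obtain ⟨c, hc0, hc, hcs⟩ := exists_curve_in_fiber 𝒢.isSubmersion_src (𝒢.one x) v.1 v.2
  rw [𝒢.src_one] at hcs
  have h1 := 𝒢.hasDerivAt_eulerLagrange (hL'.comp Φ.contMDiff_toFun) g h x hg hh v hc0 hc hcs
  have h2 := 𝒢'.hasDerivAt_eulerLagrange hL' (Φ.toFun g) (Φ.toFun h) (Φ.base x)
    ((Φ.tgt_toFun g).trans (congrArg Φ.base hg)) ((Φ.src_toFun h).trans (congrArg Φ.base hh))
    (Φ.algebroidMap x v) (c := Φ.toFun ∘ c)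
    (by rw [Function.comp_apply, hc0, Φ.toFun_one])
    ((Φ.hasMFDerivAt_toFun _).comp_curve hc0 hc)
    (by filter_upwards [hcs] with s hs
        rw [Function.comp_apply, Φ.src_toFun, hs])
  refine h1.unique (h2.congr_of_eventuallyEq ?_)
  filter_upwards [hcs] with s hs
  simp only [Function.comp_apply]
  rw [Φ.map_mul _ _ (hg.trans hs.symm), Φ.map_mul _ _ (by rw [𝒢.tgt_inv, hs, hh]), Φ.toFun_inv]

variable [IsManifold 𝓘(ℝ, E') ∞ G'] [IsManifold 𝓘(ℝ, F') ∞ M']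

/-- Naturality of `x(Y(L)) - (∇_x Y)(L)` under morphisms. -/
theorem vectorDeriv_sub_derivAlongTgt_comp {L' : G' → ℝ}
    (hL' : ContMDiff 𝓘(ℝ, E') 𝓘(ℝ, ℝ) ∞ L') (g : G)
    (x : TangentSpace 𝓘(ℝ, E) g) (hx : x ∈ 𝒢.vertTgt g)
    (Y : ∀ k : G, TangentSpace 𝓘(ℝ, E) k) (hY : ∀ k, Y k ∈ 𝒢.vertSrc k)
    (hYs : ContMDiff 𝓘(ℝ, E) 𝓘(ℝ, E).tangent ∞
      (fun g => (⟨g, Y g⟩ : TangentBundle 𝓘(ℝ, E) G)))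
    (Y' : ∀ k : G', TangentSpace 𝓘(ℝ, E') k) (hY' : ∀ k, Y' k ∈ 𝒢'.vertSrc k)
    (hYs' : ContMDiff 𝓘(ℝ, E') 𝓘(ℝ, E').tangent ∞
      (fun g => (⟨g, Y' g⟩ : TangentBundle 𝓘(ℝ, E') G')))
    (hYY' : Y' (Φ.toFun g) = mfderiv 𝓘(ℝ, E) 𝓘(ℝ, E') Φ.toFun g (Y g)) :
    vectorDeriv (fun k => vectorDeriv L' k (Y' k)) (Φ.toFun g)
        (mfderiv 𝓘(ℝ, E) 𝓘(ℝ, E') Φ.toFun g x)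
      - vectorDeriv L' (Φ.toFun g)
        (𝒢'.derivAlongTgt (Φ.toFun g) (mfderiv 𝓘(ℝ, E) 𝓘(ℝ, E') Φ.toFun g x) Y') =
    vectorDeriv (fun k => vectorDeriv (L' ∘ Φ.toFun) k (Y k)) g x
      - vectorDeriv (L' ∘ Φ.toFun) g (𝒢.derivAlongTgt g x Y) := by
  obtain ⟨γ, hγ0, hγ, hγs⟩ := exists_curve_in_fiber 𝒢.isSubmersion_tgt g x hx
  obtain ⟨η, hη0, hη, hηs⟩ := exists_curve_in_fiber 𝒢.isSubmersion_src g (Y g) (hY g)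
  have h1 := 𝒢.hasDerivAt_deriv_mul (hL'.comp Φ.contMDiff_toFun) g Y hY hYs x hx hγ0 hγ hγs
    hη0 hη hηs
  have hη' := (Φ.hasMFDerivAt_toFun g).comp_curve hη0 hη
  have h2 := 𝒢'.hasDerivAt_deriv_mul hL' (Φ.toFun g) Y' hY' hYs' _
    (Φ.mfderiv_mem_vertTgt g x hx) (γ := Φ.toFun ∘ γ) (η := Φ.toFun ∘ η)
    (by rw [Function.comp_apply, hγ0]) ((Φ.hasMFDerivAt_toFun g).comp_curve hγ0 hγ)
    (by filter_upwards [hγs] with t ht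
        rw [Function.comp_apply, Φ.tgt_toFun, Φ.tgt_toFun, ht])
    (by rw [Function.comp_apply, hη0])
    -- The velocity of `Φ ∘ η` is the image of `Y(g)`; the hypothesis at the single point `Φ(g)`
    -- identifies it with the value of `Y'`.
    (hη'.congr_mfderiv (congrArg
      (fun y : E' => (ContinuousLinearMap.toSpanSingleton ℝ y : ℝ →L[ℝ] E')) hYY'.symm))
    (by filter_upwards [hηs] with s hs
        rw [Function.comp_apply, Φ.src_toFun, Φ.src_toFun, hs])
  refine h2.unique (h1.congr_of_eventuallyEq ?_)
  filter_upwards [hγs] with t ht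
  refine Filter.EventuallyEq.deriv_eq ?_
  filter_upwards [hηs] with s hs
  simp only [Function.comp_apply]
  have e1 : 𝒢.tgt (γ t) = 𝒢.src (𝒢.inv g) := by rw [𝒢.src_inv, ht]
  -- `Φ(γ(t) g⁻¹ η(s)) = Φ(γ(t)) Φ(g)⁻¹ Φ(η(s))`, so both mixed derivatives are those of the same
  -- function.
  rw [Φ.map_mul _ _ (by rw [𝒢.tgt_mul_inv _ _ ht.symm, hs]), Φ.map_mul _ _ e1, Φ.toFun_inv]

theorem pullbackTwo_omega [FiniteDimensional ℝ E] [FiniteDimensional ℝ E'] [T2Space G]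
    [T2Space G'] {L' : G' → ℝ} (hL' : ContMDiff 𝓘(ℝ, E') 𝓘(ℝ, ℝ) ∞ L') :
    Φ.pullbackTwo (𝒢'.omega L') = 𝒢.omega (L' ∘ Φ.toFun) := by
  funext g z w
  -- The sections upstairs and downstairs are compared only at `g` and `Φ(g)`. This is all that the
  -- choices made in `differential` provide.
  have key : ∀ (Z W : 𝒢.ProlongationSection) (Z' W' : 𝒢'.ProlongationSection),
      Z'.toFun (Φ.toFun g) = Φ.prolongation g (Z.toFun g) →
      W'.toFun (Φ.toFun g) = Φ.prolongation g (W.toFun g) →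
      𝒢'.differentialOn (𝒢'.thetaPlus L') Z' W' (Φ.toFun g) =
        𝒢.differentialOn (𝒢.thetaPlus (L' ∘ Φ.toFun)) Z W g := by
    intro Z W Z' W' hZ hW
    have nat := fun (X Y : 𝒢.ProlongationSection) (Y' : 𝒢'.ProlongationSection)
        (h : Y'.toFun (Φ.toFun g) = Φ.prolongation g (Y.toFun g)) =>
      Φ.vectorDeriv_sub_derivAlongTgt_comp hL' g (X.toFun g).1.1 (X.toFun g).1.2
        (fun k => (Y.toFun k).2.1) (fun k => (Y.toFun k).2.2) Y.contMDiff_snd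
        (fun k => (Y'.toFun k).2.1) (fun k => (Y'.toFun k).2.2) Y'.contMDiff_snd
        (congrArg (fun u => u.2.1) h)
    rw [𝒢'.differentialOn_thetaPlus hL',
      𝒢.differentialOn_thetaPlus (hL'.comp Φ.contMDiff_toFun), ← nat Z W W' hW, ← nat W Z Z' hZ,
      hZ, hW]
    rfl
  refine congrArg Neg.neg (key _ _ _ _ ?_ ?_)
  · rw [(𝒢.exists_section_through g z).choose_spec]
    exact (𝒢'.exists_section_through _ _).choose_spec
  · rw [(𝒢.exists_section_through g w).choose_spec]
    exact (𝒢'.exists_section_through _ _).choose_spec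

end LieGroupoidMorphism

theorem mainTheorem6 {E F G M E' F' G' M' : Type*}
    [NormedAddCommGroup E] [NormedSpace ℝ E] [FiniteDimensional ℝ E]
    [NormedAddCommGroup F] [NormedSpace ℝ F] [FiniteDimensional ℝ F]
    [TopologicalSpace G] [T2Space G] [ChartedSpace E G] [IsManifold 𝓘(ℝ, E) ∞ G]
    [TopologicalSpace M] [ChartedSpace F M] [IsManifold 𝓘(ℝ, F) ∞ M]
    [NormedAddCommGroup E'] [NormedSpace ℝ E'] [FiniteDimensional ℝ E']
    [NormedAddCommGroup F'] [NormedSpace ℝ F'] [FiniteDimensional ℝ F']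
    [TopologicalSpace G'] [T2Space G'] [ChartedSpace E' G'] [IsManifold 𝓘(ℝ, E') ∞ G']
    [TopologicalSpace M'] [ChartedSpace F' M'] [IsManifold 𝓘(ℝ, F') ∞ M']
    (𝒢 : LieGroupoid E F G M) (𝒢' : LieGroupoid E' F' G' M') (Φ : LieGroupoidMorphism 𝒢 𝒢')
    (L : G → ℝ) (L' : G' → ℝ) (hL' : ContMDiff 𝓘(ℝ, E') 𝓘(ℝ, ℝ) ∞ L')
    (hLL' : L = L' ∘ Φ.toFun) :
    (∀ (g h : G) (x : M) (hg : 𝒢.tgt g = x) (hh : 𝒢.src h = x) (v : 𝒢.algebroidFiber x),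
      𝒢.eulerLagrange L g h x hg hh v =
        𝒢'.eulerLagrange L' (Φ.toFun g) (Φ.toFun h) (Φ.base x)
          ((Φ.tgt_toFun g).trans (congrArg Φ.base hg))
          ((Φ.src_toFun h).trans (congrArg Φ.base hh)) (Φ.algebroidMap x v)) ∧
    Φ.pullbackOne (𝒢'.thetaPlus L') = 𝒢.thetaPlus L ∧
    Φ.pullbackOne (𝒢'.thetaMinus L') = 𝒢.thetaMinus L ∧
    Φ.pullbackTwo (𝒢'.omega L') = 𝒢.omega L := by
  subst hLL'
  exact ⟨fun g h x hg hh v => Φ.eulerLagrange_comp hL' g h x hg hh v,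
    Φ.pullbackOne_thetaPlus hL', Φ.pullbackOne_thetaMinus hL', Φ.pullbackTwo_omega hL'⟩
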